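/- **Theorem 1 (discrete stability).** Let $\alpha\in(0,1)$. There is a constant $c>0$ depending only on $\alpha$ and, for every $T>0$, a constant $c(T)>0$ depending only on $\alpha$ and $T$, such that the following holds for all dimensions $d$, all symmetric real $d\times d$ matrices $M$ (positive definite), $C,K$ (positive semidefinite), all $J\in\mathbb N$, $J\ge1$, with $\Delta t=T/J$, and each sign $s\in\{1,-1\}$. Let $b_0=\frac{\Delta t^{1-\alpha}}{\Gamma(3-\alpha)}$ and $b_l=\frac{\Delta t^{1-\alpha}}{\Gamma(3-\alpha)}\bigl((l+1)^{2-\alpha}-2l^{2-\alpha}+(l-1)^{2-\alpha}\bigr)$ for $l\ge1$ (the Galerkin coefficients of the Abel integral operator $I^{1-\alpha}$). For vectors $v_0,v_1,\dots$ and $f_0,f_1,\dots$ in $\mathbb R^d$ put $\hat v_n=\frac{v_{n+1}+v_n}2$, $\tilde v_0=\frac{v_1+v_0}2$ and, for $n\ge1$, $\tilde v_n=\frac{v_{n+1}+2v_n+v_{n-1}}4$, $\tilde f_n=\frac{f_{n+1}+2f_n+f_{n-1}}4$; further let $r_0^n=\frac{b_{n+1}v_0+s\,b_nv_1}4$ for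 $n\ge0$. Suppose that, for some $d_0\in\mathbb R^d$, the three-stage Newmark scheme ($\gamma=\frac12$, $\beta=\frac14$) $$M\,\frac{v_{n+1}-v_{n-1}}{2\Delta t}+C\Bigl[\sum_{j=0}^n b_j\tilde v_{n-j}+r_0^n\Bigr]+K\Bigl[d_0+\Delta t\sum_{j=1}^n\frac{\tilde v_j+\tilde v_{j-1}}2\Bigr]=\tilde f_n$$ holds for $n=1,\dots,J$. Let $\hat t_{0-}=0$, $\hat t_{i-}=(i-\frac12)\Delta t$ for $1\le i\le J$, $\hat t_{i+}=(i+\frac12)\Delta t$ for $0\le i<J$, $\hat t_{J+}=T$, let $\phi_i$ be the indicator function of $[\hat t_{i-},\hat t_{i+}]$, and put $\tilde v_J(t)=\sum_{n=0}^{J}\tilde v_n\phi_n(t)$, $r_J^0(t)=\sum_{n=0}^{J}r_0^n\phi_n(t)$. For $\sigma<\frac12$ write $\|g\|_{H^\sigma(0,t)}^2=\int_{\mathbb R}(1+\omega^2)^\sigma|\mathcal F(1_{(0,t)}g)(\omega)|^2\,d\omega$, where $\mathcal F$ is the unitary Fourier transform. Then for every $N\in\{1,\dots,J\}$, with $t=\hat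 t_{N+}$, $$|M^{1/2}\hat v_N|^2+\|C^{1/2}\tilde v_J\|^2_{H^{-(1-\alpha)/2}(0,t)}+\Bigl|K^{1/2}\Delta t\sum_{n=0}^N\tilde v_n\Bigr|^2\le c(T)\Bigl(E_0+\Delta t\sum_{n=1}^N|M^{-1/2}\tilde f_n|^2\Bigr)$$ and $$\max_{1\le n\le N}|M^{1/2}\hat v_n|^2+\|C^{1/2}\tilde v_J\|^2_{H^{-(1-\alpha)/2}(0,t)}+\Bigl|K^{1/2}\Delta t\sum_{n=0}^N\tilde v_n\Bigr|^2\le c\Bigl(E_0+\Bigl(\Delta t\sum_{n=1}^N|M^{-1/2}\tilde f_n|\Bigr)^2\Bigr),$$ where $E_0=|M^{1/2}\hat v_0|^2+|K^{1/2}d_0|^2+|\Delta t\,K^{1/2}\tilde v_0|^2+\|C^{1/2}r_J^0\|^2_{H^{(1-\alpha)/2}(0,t)}$; in the case $N=1$ it is assumed in addition that $b_1^2\ne b_0b_2$, i.e. $(2^{2-\alpha}-2)^2\ne 3^{2-\alpha}-2\cdot2^{2-\alpha}+1$ (which excludes an isolated value $\alpha\approx0.639$). -/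

import Mathlib

open scoped MatrixOrder

noncomputable section

namespace FracNewmark

/-- The nonnegative square root `A^{1/2}` of a real positive semidefinite matrix. -/
def msqrt {d : ℕ} (A : Matrix (Fin d) (Fin d) ℝ) : Matrix (Fin d) (Fin d) ℝ :=
  CFC.sqrt A

/-- The matrix-vector product on Euclidean space. -/
def app {d : ℕ} (A : Matrix (Fin d) (Fin d) ℝ) (x : EuclideanSpace ℝ (Fin d)) :
    EuclideanSpace ℝ (Fin d) :=
  WithLp.toLp 2 (A.mulVec x.ofLp)

/-- The Galerkin coefficients of the Abel integral operator `I^{1-α}` for piecewise constants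
on a uniform grid with step `τ`. They do not depend on the upper index `n`. -/
def galerkinCoeff (α τ : ℝ) : ℕ → ℝ
  | 0 => τ ^ (1 - α) / Real.Gamma (3 - α)
  | l + 1 => τ ^ (1 - α) / Real.Gamma (3 - α) *
      (((l : ℝ) + 2) ^ (2 - α) - 2 * ((l : ℝ) + 1) ^ (2 - α) + (l : ℝ) ^ (2 - α))

/-- `v̂_n = (v_{n+1} + v_n) / 2`. -/
def vHat {d : ℕ} (v : ℕ → EuclideanSpace ℝ (Fin d)) (n : ℕ) : EuclideanSpace ℝ (Fin d) :=
  (1 / 2 : ℝ) • (v (n + 1) + v n)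

/-- `ṽ_0 = (v_1 + v_0) / 2` and `ṽ_n = (v_{n+1} + 2 v_n + v_{n-1}) / 4` for `n ≥ 1`. -/
def vTilde {d : ℕ} (v : ℕ → EuclideanSpace ℝ (Fin d)) : ℕ → EuclideanSpace ℝ (Fin d)
  | 0 => (1 / 2 : ℝ) • (v 1 + v 0)
  | n + 1 => (1 / 4 : ℝ) • (v (n + 2) + (2 : ℝ) • v (n + 1) + v n)

/-- `f̃_n = (f_{n+1} + 2 f_n + f_{n-1}) / 4`; used for `n ≥ 1` only. -/
def fTilde {d : ℕ} (f : ℕ → EuclideanSpace ℝ (Fin d)) (n : ℕ) : EuclideanSpace ℝ (Fin d) :=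
  (1 / 4 : ℝ) • (f (n + 1) + (2 : ℝ) • f n + f (n - 1))

/-- The initial correction `r_0^n = (b_{n+1} v_0 + s b_n v_1) / 4`, with a sign `s = ±1`. -/
def initCorr {d : ℕ} (α τ s : ℝ) (v : ℕ → EuclideanSpace ℝ (Fin d)) (n : ℕ) :
    EuclideanSpace ℝ (Fin d) :=
  (1 / 4 : ℝ) • (galerkinCoeff α τ (n + 1) • v 0 + (s * galerkinCoeff α τ n) • v 1)

/-- The three-stage form of the Newmark scheme (`γ = 1/2`, `β = 1/4`) with Galerkin coefficients
and time step `τ`, at all the steps `n = 1, …, J`. -/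
def IsSchemeSolution {d : ℕ} (M C K : Matrix (Fin d) (Fin d) ℝ) (α τ s : ℝ) (J : ℕ)
    (d₀ : EuclideanSpace ℝ (Fin d)) (v f : ℕ → EuclideanSpace ℝ (Fin d)) : Prop :=
  ∀ n ∈ Finset.Icc 1 J,
    app M ((1 / (2 * τ)) • (v (n + 1) - v (n - 1)))
      + app C (∑ j ∈ Finset.range (n + 1), galerkinCoeff α τ j • vTilde v (n - j)
          + initCorr α τ s v n)
      + app K (d₀ + τ • ∑ j ∈ Finset.Icc 1 n, (1 / 2 : ℝ) • (vTilde v j + vTilde v (j - 1)))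
    = fTilde f n

/-- The left cell end `t̂_{i-}`: `(i - 1/2) τ` with `τ = T / J`, except that `t̂_{0-} = 0`. -/
def cellLeft (T : ℝ) (J i : ℕ) : ℝ :=
  if i = 0 then 0 else ((i : ℝ) - 1 / 2) * (T / J)

/-- The right cell end `t̂_{i+}`: `(i + 1/2) τ` with `τ = T / J`, except that `t̂_{J+} = T`. -/
def cellRight (T : ℝ) (J i : ℕ) : ℝ :=
  if i = J then T else ((i : ℝ) + 1 / 2) * (T / J)

/-- The piecewise constant function `∑_{n=0}^{J} w_n φ_n(t)`, where `φ_n` is the indicator function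
of the cell `[t̂_{n-}, t̂_{n+}]`. -/
def stepFun {d : ℕ} (T : ℝ) (J : ℕ) (w : ℕ → EuclideanSpace ℝ (Fin d)) (t : ℝ) :
    EuclideanSpace ℝ (Fin d) :=
  ∑ n ∈ Finset.range (J + 1),
    (Set.Icc (cellLeft T J n) (cellRight T J n)).indicator (fun _ => w n) t

/-- The (unitary) Fourier transform at frequency `ω` of `g` restricted to `(0, t)` and extended by
zero to the real line. -/
def fourierZeroExt (t : ℝ) (g : ℝ → ℝ) (ω : ℝ) : ℂ :=
  (1 / Real.sqrt (2 * Real.pi) : ℝ) *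
    ∫ x in (0 : ℝ)..t, Complex.exp (-((ω * x : ℝ) : ℂ) * Complex.I) * ((g x : ℝ) : ℂ)

/-- The squared norm `‖g‖²_{H^σ(0,t)} = ∫ (1 + ω²)^σ |𝓕 g(ω)|² dω` (extension by zero, summed over
the components of `g`). For a step function the integrand decays like `|ω|^{2σ-2}`, so that the
integral converges whenever `σ < 1/2`. -/
def sobolevNormSq {d : ℕ} (σ t : ℝ) (g : ℝ → EuclideanSpace ℝ (Fin d)) : ℝ :=
  ∑ i : Fin d, ∫ ω : ℝ, (1 + ω ^ 2) ^ σ * ‖fourierZeroExt t (fun x => g x i) ω‖ ^ 2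

/-- The damping part and the stiffness part of the discrete energy,
`‖C^{1/2} ṽ_J‖²_{H^{-(1-α)/2}(0, t̂_{N+})} + |K^{1/2} τ ∑_{n=0}^N ṽ_n|²`. -/
def dampStiffEnergy {d : ℕ} (C K : Matrix (Fin d) (Fin d) ℝ) (α T : ℝ) (J N : ℕ)
    (v : ℕ → EuclideanSpace ℝ (Fin d)) : ℝ :=
  sobolevNormSq (-(1 - α) / 2) (cellRight T J N)
      (fun t => app (msqrt C) (stepFun T J (vTilde v) t))
    + ‖app (msqrt K) ((T / J) • ∑ n ∈ Finset.range (N + 1), vTilde v n)‖ ^ 2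

/-- The data terms `|M^{1/2} v̂_0|² + |K^{1/2} d_0|² + |τ K^{1/2} ṽ_0|²
+ ‖C^{1/2} r^0_J‖²_{H^{(1-α)/2}(0, t̂_{N+})}`. -/
def initialTerms {d : ℕ} (M C K : Matrix (Fin d) (Fin d) ℝ) (α T s : ℝ) (J N : ℕ)
    (d₀ : EuclideanSpace ℝ (Fin d)) (v : ℕ → EuclideanSpace ℝ (Fin d)) : ℝ :=
  ‖app (msqrt M) (vHat v 0)‖ ^ 2 + ‖app (msqrt K) d₀‖ ^ 2
    + ‖(T / J) • app (msqrt K) (vTilde v 0)‖ ^ 2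
    + sobolevNormSq ((1 - α) / 2) (cellRight T J N)
        (fun t => app (msqrt C) (stepFun T J (initCorr α (T / J) s v) t))

end FracNewmark

end

noncomputable section

namespace FracNewmark

open MeasureTheory Finset

/-! Testing the scheme with `ṽ_n = (v̂_n + v̂_{n-1}) / 2` gives an exact discrete energy balance:
the mass and stiffness terms telescope (`energy_step`). What remains is a lower bound for the
accumulated damping power.

With `p = 2 - α`, the coefficients `b_l` are second differences of `|l| ^ p`. Since `|x| ^ p` is a
superposition of the functions `1 - cos (x θ)` with weight `|θ| ^ (-1 - p)`, the quadratic form of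
the `b_l` is an integral of a nonnegative `symbol` against `|P|²`, where `P` is the trigonometric
polynomial of the sequence (`sum_galerkinCoeff_mul`). This integral `spec` is, up to a power of the
step, a homogeneous negative Sobolev norm of a step function, and it dominates the `H^{-(1-α)/2}`
norm. The initial correction is absorbed by duality: Parseval on `[-π, π]` and the lower bound of
the symbol there pair `spec` with `low`, which the `H^{(1-α)/2}` norm dominates (`pairing_le`,
`low_le_sobolevScalar`). Only homogeneous weights enter, so no constant depends on `T` or on the
mesh.

Two defects need care. Cell `0` has half the length of an interior cell, so Fourier transforms are
taken on the grid of half cells, at the price of two boundary values (`exists_spec_halfSeq_le`).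
Moreover the balance starts at `n = 1`, so the term `b_0 ṽ_0²` of the positive form is missing. It
is recovered from two initial corrections, a linear system for `v_0` and `v_1` that is solvable
unless consecutive coefficients are proportional (`exists_sq_le_initCorr`).

The load is absorbed into the maximum of the kinetic energy, which avoids Gronwall's lemma
(`sup_add_le_of_energy`). The estimate with `c(T)` then follows by Cauchy–Schwarz. -/

/-! ### Fourier representation of `|x| ^ p` and of its second differences -/

theorem ae_ne_zero : ∀ᵐ x : ℝ, x ≠ 0 := by simp [ae_iff, measure_singleton]

theorem integrable_of_even {f : ℝ → ℝ} (hf : ∀ x, f (-x) = f x)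
    (h : IntegrableOn f (Set.Ioi 0)) : Integrable f := by
  have h1 : Integrable ((Set.Ioi (0 : ℝ)).indicator f) :=
    (integrable_indicator_iff measurableSet_Ioi).2 h
  refine (h1.add h1.comp_neg).congr ?_
  filter_upwards [ae_ne_zero] with x hx
  rcases lt_or_gt_of_ne hx with hx | hx
  · have : ¬ (0 < x) := by linarith
    simp [Set.indicator, hx, this, hf]
  · have : ¬ (x < 0) := by linarith
    simp [Set.indicator, hx, this]

theorem measurable_abs_rpow (q : ℝ) : Measurable fun θ : ℝ => |θ| ^ q :=
  (measurable_id.abs).pow_const q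

/-- Near `0` the integrand is `O(|θ| ^ (1 - p))`, at infinity `O(|θ| ^ (-1 - p))`; this is where `0
< p < 2` is needed. -/
theorem integrable_one_sub_cos_mul_rpow {p : ℝ} (hp1 : 0 < p) (hp2 : p < 2) (x : ℝ) :
    Integrable fun θ : ℝ => (1 - Real.cos (x * θ)) * |θ| ^ (-1 - p) := by
  have hm : Measurable fun θ : ℝ => (1 - Real.cos (x * θ)) * |θ| ^ (-1 - p) :=
    (by fun_prop : Measurable fun θ : ℝ => 1 - Real.cos (x * θ)).mul (measurable_abs_rpow _)
  refine integrable_of_even (by intro θ; simp) ?_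
  rw [← Set.Ioc_union_Ioi_eq_Ioi (zero_le_one' ℝ)]
  refine IntegrableOn.union ?_ ?_
  · have h1 : IntegrableOn (fun θ : ℝ => x ^ 2 / 2 * θ ^ (1 - p)) (Set.Ioc 0 1) := by
      have := intervalIntegral.intervalIntegrable_rpow' (a := 0) (b := 1) (r := 1 - p)
        (by linarith)
      rw [intervalIntegrable_iff_integrableOn_Ioc_of_le zero_le_one] at this
      exact this.const_mul _
    refine Integrable.mono' h1 hm.aestronglyMeasurable ?_
    refine (ae_restrict_iff' measurableSet_Ioc).2 (Filter.Eventually.of_forall ?_)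
    intro θ hθ
    have hθ0 : 0 < θ := hθ.1
    have h2 : 0 ≤ 1 - Real.cos (x * θ) := by linarith [Real.cos_le_one (x * θ)]
    rw [Real.norm_of_nonneg (by positivity), abs_of_pos hθ0]
    have h3 : 1 - Real.cos (x * θ) ≤ (x * θ) ^ 2 / 2 := by
      linarith [Real.one_sub_sq_div_two_le_cos (x := x * θ)]
    calc _ ≤ (x * θ) ^ 2 / 2 * θ ^ (-1 - p) := by gcongr
      _ = x ^ 2 / 2 * (θ ^ (2 : ℝ) * θ ^ (-1 - p)) := by
        rw [Real.rpow_two]; ring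
      _ = _ := by rw [← Real.rpow_add hθ0]; ring_nf
  · have h1 : IntegrableOn (fun θ : ℝ => 2 * θ ^ (-1 - p)) (Set.Ioi 1) :=
      (integrableOn_Ioi_rpow_of_lt (by linarith) one_pos).const_mul _
    refine Integrable.mono' h1 hm.aestronglyMeasurable ?_
    refine (ae_restrict_iff' measurableSet_Ioi).2 (Filter.Eventually.of_forall ?_)
    intro θ hθ
    have hθ0 : 0 < θ := zero_lt_one.trans hθ
    have h2 : 0 ≤ 1 - Real.cos (x * θ) := by linarith [Real.cos_le_one (x * θ)]
    rw [Real.norm_of_nonneg (by positivity), abs_of_pos hθ0]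
    have := Real.neg_one_le_cos (x * θ)
    gcongr
    linarith

/-- The constant in the Lévy–Khintchine type formula for `|x| ^ p`. -/
def levyConst (p : ℝ) : ℝ := ∫ θ : ℝ, (1 - Real.cos θ) * |θ| ^ (-1 - p)

theorem integral_one_sub_cos_mul_rpow {p : ℝ} (hp : 0 < p) (x : ℝ) :
    ∫ θ : ℝ, (1 - Real.cos (x * θ)) * |θ| ^ (-1 - p) = |x| ^ p * levyConst p := by
  rcases eq_or_ne x 0 with rfl | hx
  · simp [Real.zero_rpow hp.ne']
  have hx' : 0 < |x| := abs_pos.2 hx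
  have h := Measure.integral_comp_mul_left (fun θ : ℝ => (1 - Real.cos θ) * |θ| ^ (-1 - p)) x
  have h2 : (fun θ : ℝ => (1 - Real.cos (x * θ)) * |θ| ^ (-1 - p))
      = fun θ => |x| ^ (1 + p) * ((1 - Real.cos (x * θ)) * |x * θ| ^ (-1 - p)) := by
    funext θ
    rw [abs_mul, Real.mul_rpow (abs_nonneg _) (abs_nonneg _)]
    have : |x| ^ (1 + p) * |x| ^ (-1 - p) = 1 := by
      rw [← Real.rpow_add hx']; ring_nf; simp
    linear_combination (-(1 - Real.cos (x * θ)) * |θ| ^ (-1 - p)) * this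
  rw [h2, integral_const_mul, h, levyConst, smul_eq_mul, ← mul_assoc, abs_inv]
  congr 1
  rw [Real.rpow_add hx', Real.rpow_one]
  field_simp

/-- The weight `2 (1 - cos θ) |θ| ^ (-1 - p)`. -/
def symbol (p θ : ℝ) : ℝ := 2 * (1 - Real.cos θ) * |θ| ^ (-1 - p)

theorem symbol_nonneg (p θ : ℝ) : 0 ≤ symbol p θ := by
  have := Real.cos_le_one θ
  unfold symbol
  have : 0 ≤ 1 - Real.cos θ := by linarith
  positivity

theorem integrable_symbol {p : ℝ} (hp1 : 0 < p) (hp2 : p < 2) : Integrable (symbol p) := by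
  have := (integrable_one_sub_cos_mul_rpow hp1 hp2 1).const_mul 2
  refine this.congr (Filter.Eventually.of_forall fun θ => ?_)
  simp only [symbol, one_mul]; ring

theorem integral_symbol (p : ℝ) : ∫ θ, symbol p θ = 2 * levyConst p := by
  rw [levyConst, ← integral_const_mul]
  congr 1; funext θ; simp only [symbol]; ring

/-- The second difference of `l ↦ 1 - cos (l θ)` is `2 (1 - cos θ) cos (l θ)`. Integrating over the
whole line, instead of periodizing to the torus, keeps the symbol explicit. -/
theorem integral_symbol_mul_cos {p : ℝ} (hp1 : 0 < p) (hp2 : p < 2) (l : ℝ) :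
    ∫ θ : ℝ, symbol p θ * Real.cos (l * θ)
      = levyConst p * (|l + 1| ^ p - 2 * |l| ^ p + |l - 1| ^ p) := by
  have h1 := integrable_one_sub_cos_mul_rpow hp1 hp2 (l + 1)
  have h2 := integrable_one_sub_cos_mul_rpow hp1 hp2 l
  have h3 := integrable_one_sub_cos_mul_rpow hp1 hp2 (l - 1)
  have : (fun θ : ℝ => symbol p θ * Real.cos (l * θ)) = fun θ =>
      ((1 - Real.cos ((l + 1) * θ)) * |θ| ^ (-1 - p)
        - 2 * ((1 - Real.cos (l * θ)) * |θ| ^ (-1 - p)))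
        + (1 - Real.cos ((l - 1) * θ)) * |θ| ^ (-1 - p) := by
    funext θ
    simp only [symbol, add_mul, sub_mul, one_mul, Real.cos_add, Real.cos_sub]
    ring
  have h12 : Integrable fun θ : ℝ => (1 - Real.cos ((l + 1) * θ)) * |θ| ^ (-1 - p)
      - 2 * ((1 - Real.cos (l * θ)) * |θ| ^ (-1 - p)) := h1.sub (h2.const_mul 2)
  rw [this, integral_add h12 h3, integral_sub h1 (h2.const_mul 2),
    integral_const_mul, integral_one_sub_cos_mul_rpow hp1, integral_one_sub_cos_mul_rpow hp1,
    integral_one_sub_cos_mul_rpow hp1]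
  ring

/-- The lower bound for the weight on the frequency band `[-π, π]`. -/
theorem le_symbol {p θ : ℝ} (hθ : θ ≠ 0) (h : |θ| ≤ Real.pi) :
    4 / Real.pi ^ 2 * |θ| ^ (1 - p) ≤ symbol p θ := by
  have h1 := Real.cos_le_one_sub_mul_cos_sq h
  have hθ' : 0 < |θ| := abs_pos.2 hθ
  have h2 : |θ| ^ (1 - p) = θ ^ 2 * |θ| ^ (-1 - p) := by
    rw [← sq_abs, ← Real.rpow_two, ← Real.rpow_add hθ']; ring_nf
  rw [h2, symbol, ← mul_assoc]
  refine mul_le_mul_of_nonneg_right ?_ (by positivity)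
  have : 4 / Real.pi ^ 2 * θ ^ 2 = 2 * (2 / Real.pi ^ 2 * θ ^ 2) := by ring
  linarith

theorem levyConst_pos {p : ℝ} (hp1 : 0 < p) (hp2 : p < 2) : 0 < levyConst p := by
  have h : 0 < ∫ θ, symbol p θ := by
    rw [integral_pos_iff_support_of_nonneg (symbol_nonneg p) (integrable_symbol hp1 hp2)]
    refine lt_of_lt_of_le ?_ (measure_mono (s := Set.Ioo 0 1) ?_)
    · simp
    · intro θ hθ
      have := le_symbol (p := p) hθ.1.ne'
        (by rw [abs_of_pos hθ.1]; linarith [hθ.2, Real.pi_gt_three])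
      have h3 : 0 < |θ| := abs_pos.2 hθ.1.ne'
      have h2 : 0 < 4 / Real.pi ^ 2 * |θ| ^ (1 - p) := by positivity
      exact (h2.trans_le this).ne'
  rw [integral_symbol] at h
  linarith

/-! ### Quadratic forms of trigonometric polynomials and their duality -/

/-- The trigonometric polynomial with coefficients `x 0, …, x (n - 1)`. -/
def trigPoly (n : ℕ) (x : ℕ → ℝ) (θ : ℝ) : ℂ :=
  ∑ k ∈ range n, (x k : ℂ) * Complex.exp (-((k * θ : ℝ) : ℂ) * Complex.I)

theorem exp_neg_mul_I (t : ℝ) :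
    Complex.exp (-((t : ℝ) : ℂ) * Complex.I) = ⟨Real.cos t, -Real.sin t⟩ := by
  rw [Complex.exp_mul_I]
  apply Complex.ext <;> simp [Complex.cos_ofReal_re, Complex.sin_ofReal_re]

theorem trigPoly_re (n : ℕ) (x : ℕ → ℝ) (θ : ℝ) :
    (trigPoly n x θ).re = ∑ k ∈ range n, x k * Real.cos (k * θ) := by
  simp only [trigPoly, exp_neg_mul_I, Complex.re_sum]
  simp

theorem trigPoly_im (n : ℕ) (x : ℕ → ℝ) (θ : ℝ) :
    (trigPoly n x θ).im = -∑ k ∈ range n, x k * Real.sin (k * θ) := by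
  simp only [trigPoly, exp_neg_mul_I, Complex.im_sum]
  simp

@[fun_prop]
theorem continuous_trigPoly (n : ℕ) (x : ℕ → ℝ) : Continuous (trigPoly n x) := by
  unfold trigPoly; fun_prop

theorem norm_sq_trigPoly (n : ℕ) (x : ℕ → ℝ) (θ : ℝ) :
    ‖trigPoly n x θ‖ ^ 2 = (∑ k ∈ range n, x k * Real.cos (k * θ)) ^ 2
      + (∑ k ∈ range n, x k * Real.sin (k * θ)) ^ 2 := by
  rw [Complex.sq_norm, Complex.normSq_apply, trigPoly_re, trigPoly_im]; ring

theorem norm_trigPoly_le (n : ℕ) (x : ℕ → ℝ) (θ : ℝ) :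
    ‖trigPoly n x θ‖ ≤ ∑ k ∈ range n, |x k| := by
  refine (norm_sum_le _ _).trans (Finset.sum_le_sum fun k _ => ?_)
  rw [norm_mul, ← Complex.ofReal_neg, Complex.norm_exp_ofReal_mul_I]
  simp

theorem norm_sq_trigPoly_succ (n : ℕ) (x : ℕ → ℝ) (θ : ℝ) :
    ‖trigPoly (n + 1) x θ‖ ^ 2 = ‖trigPoly n x θ‖ ^ 2
      + 2 * x n * ∑ k ∈ range n, x k * Real.cos (((n - k : ℕ) : ℝ) * θ) + x n ^ 2 := by
  have h : ∑ k ∈ range n, x k * Real.cos (((n - k : ℕ) : ℝ) * θ)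
      = Real.cos (n * θ) * ∑ k ∈ range n, x k * Real.cos (k * θ)
        + Real.sin (n * θ) * ∑ k ∈ range n, x k * Real.sin (k * θ) := by
    rw [mul_sum, mul_sum, ← sum_add_distrib]
    refine sum_congr rfl fun k hk => ?_
    rw [Nat.cast_sub (mem_range.1 hk).le, sub_mul, Real.cos_sub]; ring
  rw [norm_sq_trigPoly, norm_sq_trigPoly, h, sum_range_succ, sum_range_succ]
  linear_combination x n ^ 2 * Real.cos_sq_add_sin_sq (n * θ)

/-- The quadratic form `∫ symbol |P|²` on coefficient sequences. -/
def spec (p : ℝ) (n : ℕ) (x : ℕ → ℝ) : ℝ := ∫ θ, symbol p θ * ‖trigPoly n x θ‖ ^ 2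

/-- The dual quadratic form `∫_{-π}^{π} |θ|^(p-1) |P|²` on coefficient sequences. -/
def low (p : ℝ) (n : ℕ) (x : ℕ → ℝ) : ℝ :=
  ∫ θ in Set.Icc (-Real.pi) Real.pi, |θ| ^ (p - 1) * ‖trigPoly n x θ‖ ^ 2

theorem integrable_symbol_mul {p : ℝ} (hp1 : 0 < p) (hp2 : p < 2) {g : ℝ → ℝ} (hg : Continuous g)
    {B : ℝ} (hB : ∀ θ, |g θ| ≤ B) : Integrable fun θ => symbol p θ * g θ :=
  (integrable_symbol hp1 hp2).mul_bdd (c := B) hg.aestronglyMeasurable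
    (Filter.Eventually.of_forall hB)

theorem integrable_symbol_mul_cos {p : ℝ} (hp1 : 0 < p) (hp2 : p < 2) (l : ℝ) :
    Integrable fun θ => symbol p θ * Real.cos (l * θ) :=
  integrable_symbol_mul hp1 hp2 (by fun_prop) (fun θ => Real.abs_cos_le_one _)

theorem abs_norm_sq_trigPoly_le (n : ℕ) (x : ℕ → ℝ) (θ : ℝ) :
    |‖trigPoly n x θ‖ ^ 2| ≤ (∑ k ∈ range n, |x k|) ^ 2 := by
  rw [abs_of_nonneg (by positivity)]
  gcongr
  exact norm_trigPoly_le n x θ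

theorem integrable_symbol_trigPoly {p : ℝ} (hp1 : 0 < p) (hp2 : p < 2) (n : ℕ) (x : ℕ → ℝ) :
    Integrable fun θ => symbol p θ * ‖trigPoly n x θ‖ ^ 2 :=
  integrable_symbol_mul hp1 hp2 (by fun_prop) (abs_norm_sq_trigPoly_le n x)

theorem spec_nonneg (p : ℝ) (n : ℕ) (x : ℕ → ℝ) : 0 ≤ spec p n x :=
  integral_nonneg fun θ => mul_nonneg (symbol_nonneg _ _) (by positivity)

theorem low_nonneg (p : ℝ) (n : ℕ) (x : ℕ → ℝ) : 0 ≤ low p n x :=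
  integral_nonneg fun θ => by positivity

/-- Appending one coefficient adds a row of the Toeplitz form; this is the induction step that
matches `spec` with the causal convolution sum. -/
theorem spec_succ {p : ℝ} (hp1 : 0 < p) (hp2 : p < 2) (n : ℕ) (x : ℕ → ℝ) :
    spec p (n + 1) x = spec p n x + 2 * x n * ∑ k ∈ range n, x k *
        (levyConst p * (|((n - k : ℕ) : ℝ) + 1| ^ p - 2 * |((n - k : ℕ) : ℝ)| ^ p
          + |((n - k : ℕ) : ℝ) - 1| ^ p)) + x n ^ 2 * (2 * levyConst p) := by
  have h1 := integrable_symbol_trigPoly hp1 hp2 n x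
  have h2 : ∀ k ∈ range n, Integrable fun θ =>
      x k * (symbol p θ * Real.cos (((n - k : ℕ) : ℝ) * θ)) :=
    fun k _ => (integrable_symbol_mul_cos hp1 hp2 _).const_mul _
  have h3 : Integrable fun θ => 2 * x n * ∑ k ∈ range n,
      x k * (symbol p θ * Real.cos (((n - k : ℕ) : ℝ) * θ)) :=
    (integrable_finsetSum _ h2).const_mul _
  have h4 := (integrable_symbol hp1 hp2).const_mul (x n ^ 2)
  have : (fun θ => symbol p θ * ‖trigPoly (n + 1) x θ‖ ^ 2) = fun θ =>
      (symbol p θ * ‖trigPoly n x θ‖ ^ 2 + 2 * x n * ∑ k ∈ range n,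
        x k * (symbol p θ * Real.cos (((n - k : ℕ) : ℝ) * θ))) + x n ^ 2 * symbol p θ := by
    funext θ
    rw [norm_sq_trigPoly_succ]
    have : ∑ k ∈ range n, x k * (symbol p θ * Real.cos (((n - k : ℕ) : ℝ) * θ))
      = symbol p θ * ∑ k ∈ range n, x k * Real.cos (((n - k : ℕ) : ℝ) * θ) := by
      rw [mul_sum]; exact sum_congr rfl fun k _ => by ring
    rw [this]; ring
  have h13 : Integrable fun θ => symbol p θ * ‖trigPoly n x θ‖ ^ 2 + 2 * x n * ∑ k ∈ range n,
        x k * (symbol p θ * Real.cos (((n - k : ℕ) : ℝ) * θ)) := h1.add h3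
  rw [spec, this, integral_add h13 h4, integral_add h1 h3, integral_const_mul,
    integral_const_mul, integral_finsetSum _ h2, integral_symbol]
  simp only [integral_const_mul, integral_symbol_mul_cos hp1 hp2]
  rfl

theorem integrableOn_low {p : ℝ} (hp : 1 ≤ p) (n : ℕ) (x : ℕ → ℝ) :
    IntegrableOn (fun θ => |θ| ^ (p - 1) * ‖trigPoly n x θ‖ ^ 2)
      (Set.Icc (-Real.pi) Real.pi) := by
  refine Continuous.integrableOn_Icc ?_
  have : Continuous fun θ : ℝ => |θ| ^ (p - 1) :=
    continuous_abs.rpow_const fun _ => Or.inr (by linarith)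
  fun_prop

theorem integral_cos_int_mul (k : ℤ) :
    ∫ θ in (-Real.pi)..Real.pi, Real.cos (k * θ) = if k = 0 then 2 * Real.pi else 0 := by
  split_ifs with h
  · simp [h]; ring
  · have hk : (k : ℝ) ≠ 0 := by exact_mod_cast h
    rw [intervalIntegral.integral_comp_mul_left _ hk, integral_cos]
    simp [Real.sin_int_mul_pi]

/-- Parseval's identity for trigonometric polynomials. -/
theorem integral_trigPoly_mul (n : ℕ) (x y : ℕ → ℝ) :
    ∫ θ in (-Real.pi)..Real.pi, ((trigPoly n x θ).re * (trigPoly n y θ).re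
      + (trigPoly n x θ).im * (trigPoly n y θ).im) = 2 * Real.pi * ∑ k ∈ range n, x k * y k := by
  have : ∀ θ, (trigPoly n x θ).re * (trigPoly n y θ).re
      + (trigPoly n x θ).im * (trigPoly n y θ).im
      = ∑ i ∈ range n, ∑ j ∈ range n, x i * y j * Real.cos (((i - j : ℤ) : ℝ) * θ) := by
    intro θ
    simp only [trigPoly_re, trigPoly_im, neg_mul_neg, sum_mul_sum, ← sum_add_distrib]
    refine sum_congr rfl fun i _ => sum_congr rfl fun j _ => ?_
    push_cast
    rw [sub_mul, Real.cos_sub]; ring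
  simp only [this]
  rw [intervalIntegral.integral_finsetSum
    (fun i _ => (by fun_prop : Continuous _).intervalIntegrable _ _), mul_sum]
  refine sum_congr rfl fun i hi => ?_
  rw [intervalIntegral.integral_finsetSum
    (fun i _ => (by fun_prop : Continuous _).intervalIntegrable _ _)]
  simp only [intervalIntegral.integral_const_mul, integral_cos_int_mul]
  simp only [sub_eq_zero, Nat.cast_inj]
  simp [mem_range.1 hi]; ring

/-- The duality of `spec` and `low`. -/
theorem pairing_le {p : ℝ} (hp1 : 1 < p) (hp2 : p < 2) (n : ℕ) (x y : ℕ → ℝ) {η : ℝ}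
    (hη : 0 < η) : 2 * Real.pi * ∑ k ∈ range n, x k * y k
      ≤ η / 2 * spec p n x + Real.pi ^ 2 / (8 * η) * low p n y := by
  have hs := integrable_symbol_trigPoly (by linarith) hp2 n x
  have hl := integrableOn_low hp1.le n y
  have hpi := Real.pi_pos
  -- Parseval lives on one period, so the part of `spec` outside the band is dropped.
  have h1 : spec p n x ≥ ∫ θ in Set.Icc (-Real.pi) Real.pi, symbol p θ * ‖trigPoly n x θ‖ ^ 2 :=
    setIntegral_le_integral hs (Filter.Eventually.of_forall fun θ =>
      mul_nonneg (symbol_nonneg _ _) (by positivity))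
  rw [← integral_trigPoly_mul, intervalIntegral.integral_of_le (by linarith),
    ← integral_Icc_eq_integral_Ioc]
  calc _ ≤ ∫ θ in Set.Icc (-Real.pi) Real.pi, (η / 2 * (symbol p θ * ‖trigPoly n x θ‖ ^ 2)
        + Real.pi ^ 2 / (8 * η) * (|θ| ^ (p - 1) * ‖trigPoly n y θ‖ ^ 2)) := by
        refine setIntegral_mono_on_ae ?_ ((hs.integrableOn.const_mul _).add (hl.const_mul _))
          measurableSet_Icc ?_
        · refine Continuous.integrableOn_Icc ?_
          exact ((Complex.continuous_re.comp (continuous_trigPoly n x)).mul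
            (Complex.continuous_re.comp (continuous_trigPoly n y))).add
            ((Complex.continuous_im.comp (continuous_trigPoly n x)).mul
            (Complex.continuous_im.comp (continuous_trigPoly n y)))
        · filter_upwards [ae_ne_zero] with θ hθ hθ2
          have h4 := le_symbol (p := p) hθ (abs_le.2 hθ2)
          have hθ' : 0 < |θ| := abs_pos.2 hθ
          have h5 : |θ| ^ (1 - p) * |θ| ^ (p - 1) = 1 := by
            rw [← Real.rpow_add hθ']; simp
          set a := (trigPoly n x θ).re
          set b := (trigPoly n x θ).im
          set c := (trigPoly n y θ).re
          set d := (trigPoly n y θ).im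
          have ha : ‖trigPoly n x θ‖ ^ 2 = a ^ 2 + b ^ 2 := by
            rw [Complex.sq_norm, Complex.normSq_apply]; ring
          have hc : ‖trigPoly n y θ‖ ^ 2 = c ^ 2 + d ^ 2 := by
            rw [Complex.sq_norm, Complex.normSq_apply]; ring
          rw [ha, hc]
          have hu : 0 < |θ| ^ (1 - p) := by positivity
          have hv : 0 < |θ| ^ (p - 1) := by positivity
          generalize |θ| ^ (1 - p) = u at *
          generalize |θ| ^ (p - 1) = v at *
          -- Young's inequality with the mutually inverse weights `u` and `v`; the constants make
          -- the difference a perfect square.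
          have key : ∀ s t : ℝ, s * t ≤ η / 2 * (4 / Real.pi ^ 2 * u * s ^ 2)
              + Real.pi ^ 2 / (8 * η) * (v * t ^ 2) := by
            intro s t
            have hv' : v = 1 / u := by field_simp; linarith
            rw [hv']
            have : η / 2 * (4 / Real.pi ^ 2 * u * s ^ 2)
              + Real.pi ^ 2 / (8 * η) * (1 / u * t ^ 2) - s * t
              = 2 * η * u / Real.pi ^ 2 * (s - Real.pi ^ 2 / (4 * η * u) * t) ^ 2 := by
              field_simp; ring
            have h6 : 0 ≤ 2 * η * u / Real.pi ^ 2 * (s - Real.pi ^ 2 / (4 * η * u) * t) ^ 2 := by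
              positivity
            linarith
          have k1 := key a c
          have k2 := key b d
          have : η / 2 * (4 / Real.pi ^ 2 * u * (a ^ 2 + b ^ 2))
              ≤ η / 2 * (symbol p θ * (a ^ 2 + b ^ 2)) := by gcongr
          linarith
    _ = η / 2 * (∫ θ in Set.Icc (-Real.pi) Real.pi, symbol p θ * ‖trigPoly n x θ‖ ^ 2)
        + Real.pi ^ 2 / (8 * η) * low p n y := by
        rw [integral_add (hs.integrableOn.const_mul _) (hl.const_mul _), integral_const_mul,
          integral_const_mul]
        rfl
    _ ≤ _ := by gcongr

theorem trigPoly_single {n k : ℕ} (hk : k < n) (a θ : ℝ) :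
    ‖trigPoly n (Pi.single k a) θ‖ ^ 2 = a ^ 2 := by
  have : trigPoly n (Pi.single k a) θ
      = (a : ℂ) * Complex.exp (((-(k * θ) : ℝ) : ℂ) * Complex.I) := by
    unfold trigPoly
    rw [sum_eq_single k]
    · simp
    · intro j _ hj; simp [hj]
    · intro h; exact absurd (mem_range.2 hk) h
  rw [this, norm_mul, Complex.norm_exp_ofReal_mul_I]; simp

theorem sum_single_mul {n k : ℕ} (hk : k < n) (a : ℝ) (x : ℕ → ℝ) :
    ∑ j ∈ range n, (Pi.single k a : ℕ → ℝ) j * x j = a * x k := by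
  rw [sum_eq_single k]
  · simp
  · intro j _ hj; simp [hj]
  · intro h; exact absurd (mem_range.2 hk) h

/-- Point evaluation is bounded by testing the pairing with a unit sequence at `k`, whose polynomial
has constant modulus. -/
theorem sq_le_low {p : ℝ} (hp1 : 1 < p) (hp2 : p < 2) {n k : ℕ} (hk : k < n) (y : ℕ → ℝ) :
    y k ^ 2 ≤ levyConst p * low p n y := by
  have hκ := levyConst_pos (by linarith) hp2
  have hpi := Real.pi_gt_three
  -- This `η` makes the `spec` term equal to half of the left-hand side, so that it can be absorbed.
  have h := pairing_le hp1 hp2 n (Pi.single k (y k)) y (η := Real.pi / levyConst p) (by positivity)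
  have h2 : spec p n (Pi.single k (y k)) = 2 * levyConst p * y k ^ 2 := by
    simp only [spec, trigPoly_single hk, integral_mul_const, integral_symbol]
  rw [sum_single_mul hk, h2] at h
  have h3 : Real.pi / levyConst p / 2 * (2 * levyConst p * y k ^ 2) = Real.pi * y k ^ 2 := by
    field_simp
  have h4 : Real.pi ^ 2 / (8 * (Real.pi / levyConst p)) * low p n y
      = Real.pi * (levyConst p * low p n y / 8) := by field_simp
  rw [h3, h4] at h
  have h5 : Real.pi * y k ^ 2 ≤ Real.pi * (levyConst p * low p n y / 8) := by linarith
  have h6 := le_of_mul_le_mul_left h5 (by linarith)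
  have := mul_nonneg hκ.le (low_nonneg p n y)
  linarith

theorem exists_sq_le_spec {p : ℝ} (hp1 : 1 < p) (hp2 : p < 2) : ∃ c : ℝ, 0 < c ∧
    ∀ (n k : ℕ), k < n → ∀ x : ℕ → ℝ, x k ^ 2 ≤ c * spec p n x := by
  set L := ∫ θ in Set.Icc (-Real.pi) Real.pi, |θ| ^ (p - 1) with hL
  have hL0 : 0 ≤ L := integral_nonneg fun θ => by positivity
  have hpi := Real.pi_gt_three
  -- With `η` equal to this constant the `low` term is at most half of `2 π x_k²`; the summand `1`
  -- keeps `η` positive given only `0 ≤ L`.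
  refine ⟨Real.pi * (L + 1), by positivity, fun n k hk x => ?_⟩
  have h := pairing_le hp1 hp2 n x (Pi.single k (x k)) (η := Real.pi * (L + 1)) (by positivity)
  have h2 : low p n (Pi.single k (x k)) = L * x k ^ 2 := by
    simp only [low, trigPoly_single hk, integral_mul_const, hL]
  have h7 : ∑ j ∈ range n, x j * (Pi.single k (x k) : ℕ → ℝ) j = x k * x k := by
    rw [← sum_single_mul hk (x k) x]; exact sum_congr rfl fun j _ => mul_comm _ _
  rw [h7, h2] at h
  have h4 : Real.pi ^ 2 / (8 * (Real.pi * (L + 1))) * (L * x k ^ 2)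
      ≤ Real.pi * x k ^ 2 := by
    have : Real.pi ^ 2 / (8 * (Real.pi * (L + 1))) * (L * x k ^ 2)
      = Real.pi * x k ^ 2 * (L / (8 * (L + 1))) := by field_simp
    rw [this]
    refine mul_le_of_le_one_right (by positivity) ?_
    rw [div_le_one (by positivity)]; linarith
  have h5 := spec_nonneg p n x
  have h6 : Real.pi * x k ^ 2 ≥ 1 * x k ^ 2 := by gcongr; linarith
  have h8 : Real.pi * (L + 1) * spec p n x ≥ 0 := by positivity
  nlinarith

/-! ### The quadratic form of the Galerkin coefficients -/

theorem galerkinCoeff_zero (α τ : ℝ) :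
    galerkinCoeff α τ 0 = τ ^ (1 - α) / Real.Gamma (3 - α) := rfl

theorem galerkinCoeff_zero_pos {α τ : ℝ} (hα : α < 1) (hτ : 0 < τ) :
    0 < galerkinCoeff α τ 0 := by
  have := Real.Gamma_pos_of_pos (s := 3 - α) (by linarith)
  rw [galerkinCoeff_zero]; positivity

theorem galerkinCoeff_of_pos (α τ : ℝ) {l : ℕ} (hl : 1 ≤ l) :
    galerkinCoeff α τ l = galerkinCoeff α τ 0 *
      (|(l : ℝ) + 1| ^ (2 - α) - 2 * |(l : ℝ)| ^ (2 - α) + |(l : ℝ) - 1| ^ (2 - α)) := by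
  obtain ⟨m, rfl⟩ : ∃ m, l = m + 1 := ⟨l - 1, by omega⟩
  have h : (0 : ℝ) ≤ m := m.cast_nonneg
  rw [galerkinCoeff_zero, galerkinCoeff]
  push_cast
  rw [abs_of_nonneg (by linarith), abs_of_nonneg (by linarith), abs_of_nonneg (by linarith)]
  ring_nf

/-- The Fourier representation of the quadratic form of the Galerkin coefficients. -/
theorem sum_galerkinCoeff_mul {α : ℝ} (hα₀ : 0 < α) (hα₁ : α < 1) (τ : ℝ) (n : ℕ) (x : ℕ → ℝ) :
    2 * levyConst (2 - α) * ∑ m ∈ range n, x m * ∑ j ∈ range (m + 1),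
        galerkinCoeff α τ j * x (m - j) = galerkinCoeff α τ 0 * spec (2 - α) n x := by
  induction n with
  | zero => simp [spec, trigPoly]
  | succ n ih =>
    rw [sum_range_succ, mul_add, ih, spec_succ (by linarith) (by linarith)]
    have h : ∑ j ∈ range (n + 1), galerkinCoeff α τ j * x (n - j)
        = ∑ k ∈ range n, galerkinCoeff α τ (n - k) * x k + galerkinCoeff α τ 0 * x n := by
      rw [← sum_flip, sum_range_succ, Nat.sub_self, Nat.sub_zero]
      congr 1
      refine sum_congr rfl fun k hk => ?_
      rw [Nat.sub_sub_self (mem_range.1 hk).le]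
    have h2 : ∑ k ∈ range n, galerkinCoeff α τ (n - k) * x k = galerkinCoeff α τ 0 *
        ∑ k ∈ range n, x k * (|((n - k : ℕ) : ℝ) + 1| ^ (2 - α)
          - 2 * |((n - k : ℕ) : ℝ)| ^ (2 - α) + |((n - k : ℕ) : ℝ) - 1| ^ (2 - α)) := by
      rw [mul_sum]
      refine sum_congr rfl fun k hk => ?_
      have := mem_range.1 hk
      rw [galerkinCoeff_of_pos α τ (l := n - k) (by omega)]
      ring
    have h3 : ∑ k ∈ range n, x k * (levyConst (2 - α) * (|((n - k : ℕ) : ℝ) + 1| ^ (2 - α)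
          - 2 * |((n - k : ℕ) : ℝ)| ^ (2 - α) + |((n - k : ℕ) : ℝ) - 1| ^ (2 - α)))
        = levyConst (2 - α) * ∑ k ∈ range n, x k * (|((n - k : ℕ) : ℝ) + 1| ^ (2 - α)
          - 2 * |((n - k : ℕ) : ℝ)| ^ (2 - α) + |((n - k : ℕ) : ℝ) - 1| ^ (2 - α)) := by
      rw [mul_sum]
      exact sum_congr rfl fun k _ => by ring
    rw [h, h2, h3]
    ring

/-! ### The half grid and coercivity of the damping -/

/-- Passage to the grid of half the step: the cell of index `n ≥ 1` consists of the half cells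
`2 n - 1` and `2 n`, the cell of index `0` only of the half cell `0`. -/
def halfSeq {R : Type*} (x : ℕ → R) (k : ℕ) : R := x ((k + 1) / 2)

/-- Cell `n ≥ 1` contributes `z ^ (2 n - 1) + z ^ (2 n)`, which is `(1 + z) z ^ (2 n)` after
multiplication by `z`. Cell `0` lacks its left half, hence the extra `f 0`. The case `z = 1` serves
for plain sums. -/
theorem mul_sum_halfSeq {R : Type*} [CommRing R] (f : ℕ → R) (z : R) (N : ℕ) :
    z * ∑ k ∈ range (2 * N + 1), halfSeq f k * z ^ k + f 0
      = (1 + z) * ∑ n ∈ range (N + 1), f n * (z ^ 2) ^ n := by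
  induction N with
  | zero => simp [halfSeq]; ring
  | succ N ih =>
    rw [sum_range_succ _ (N + 1), mul_add (1 + z), ← ih,
      show 2 * (N + 1) + 1 = 2 * N + 1 + 1 + 1 by ring, sum_range_succ, sum_range_succ]
    have h1 : halfSeq f (2 * N + 1) = f (N + 1) := by
      unfold halfSeq; congr 1; omega
    have h2 : halfSeq f (2 * N + 1 + 1) = f (N + 1) := by
      unfold halfSeq; congr 1; omega
    rw [h1, h2]
    ring

theorem halfSeq_two_mul {R : Type*} (f : ℕ → R) (N : ℕ) : halfSeq f (2 * N) = f N := by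
  unfold halfSeq; congr 1; omega

theorem trigPoly_eq_sum_pow (n : ℕ) (x : ℕ → ℝ) (θ : ℝ) :
    trigPoly n x θ = ∑ k ∈ range n, (x k : ℂ) * Complex.exp (((-θ : ℝ) : ℂ) * Complex.I) ^ k := by
  refine sum_congr rfl fun k _ => ?_
  rw [← Complex.exp_nat_mul]
  congr 2
  push_cast; ring

/-- The half-grid polynomial is `1 + z` times the coarse one at doubled frequency, up to the missing
half cell at the left end and, if `nh = 2 * N`, one at the right end. The factor `3` bounds the
square of a sum of three terms. -/
theorem norm_sq_trigPoly_halfSeq_le {nh N : ℕ} (hnh : nh = 2 * N + 1 ∨ nh = 2 * N) (x : ℕ → ℝ)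
    (θ : ℝ) : ‖trigPoly nh (halfSeq x) θ‖ ^ 2
      ≤ 3 * (2 * (1 + Real.cos θ) * ‖trigPoly (N + 1) x (2 * θ)‖ ^ 2 + x 0 ^ 2 + x N ^ 2) := by
  set z := Complex.exp (((-θ : ℝ) : ℂ) * Complex.I) with hz
  have hz1 : ‖z‖ = 1 := Complex.norm_exp_ofReal_mul_I _
  have h2 : Complex.exp (((-(2 * θ) : ℝ) : ℂ) * Complex.I) = z ^ 2 := by
    rw [hz, ← Complex.exp_nat_mul]; congr 1; push_cast; ring
  have hP : trigPoly (N + 1) x (2 * θ) = ∑ n ∈ range (N + 1), (x n : ℂ) * (z ^ 2) ^ n := by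
    rw [trigPoly_eq_sum_pow, h2]
  have hfull := mul_sum_halfSeq (fun k => (x k : ℂ)) z N
  have hcast : ∀ k, halfSeq (fun k => (x k : ℂ)) k = ((halfSeq x k : ℝ) : ℂ) := fun k => rfl
  simp only [hcast] at hfull
  rw [← hP] at hfull
  have hn1z : ‖1 + z‖ ^ 2 = 2 * (1 + Real.cos θ) := by
    have hz' : z = ⟨Real.cos θ, -Real.sin θ⟩ := by
      rw [← exp_neg_mul_I, hz, Complex.ofReal_neg]
    rw [Complex.sq_norm, Complex.normSq_apply, hz']
    simp only [Complex.add_re, Complex.one_re, Complex.add_im, Complex.one_im]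
    linear_combination Real.cos_sq_add_sin_sq θ
  have key : ∀ e : ℝ, |e| ≤ |x N| →
      z * trigPoly nh (halfSeq x) θ = (1 + z) * trigPoly (N + 1) x (2 * θ) - (x 0 : ℂ)
        - (e : ℂ) * z ^ (2 * N + 1) → ‖trigPoly nh (halfSeq x) θ‖ ^ 2
      ≤ 3 * (2 * (1 + Real.cos θ) * ‖trigPoly (N + 1) x (2 * θ)‖ ^ 2 + x 0 ^ 2 + x N ^ 2) := by
    intro e he heq
    have h3 : ‖trigPoly nh (halfSeq x) θ‖ ≤ ‖1 + z‖ * ‖trigPoly (N + 1) x (2 * θ)‖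
        + |x 0| + |x N| := by
      calc ‖trigPoly nh (halfSeq x) θ‖ = ‖z * trigPoly nh (halfSeq x) θ‖ := by
            rw [norm_mul, hz1, one_mul]
        _ ≤ ‖(1 + z) * trigPoly (N + 1) x (2 * θ)‖ + ‖(x 0 : ℂ)‖ + ‖(e : ℂ) * z ^ (2 * N + 1)‖ := by
            rw [heq]
            exact (norm_sub_le _ _).trans (add_le_add (norm_sub_le _ _) le_rfl)
        _ ≤ _ := by
            rw [norm_mul, norm_mul, norm_pow, hz1, one_pow, mul_one, Complex.norm_real,
              Complex.norm_real, Real.norm_eq_abs, Real.norm_eq_abs]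
            gcongr
    rw [← hn1z, ← mul_pow, ← sq_abs (x 0), ← sq_abs (x N)]
    generalize ‖1 + z‖ * ‖trigPoly (N + 1) x (2 * θ)‖ = a at *
    have h4 := pow_le_pow_left₀ (norm_nonneg _) h3 2
    nlinarith [sq_nonneg (a - |x 0|), sq_nonneg (a - |x N|), sq_nonneg (|x 0| - |x N|)]
  rcases hnh with h | h
  · refine key 0 (by simp) ?_
    rw [← hfull, h, trigPoly_eq_sum_pow, Complex.ofReal_zero]
    ring
  · refine key (x N) le_rfl ?_
    rw [← hfull, h, trigPoly_eq_sum_pow, sum_range_succ, halfSeq_two_mul]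
    ring

/-- The factor `|1 + z|²` turns the symbol at `θ` into a multiple of the symbol at `2 θ`, and a
change of variables gives back the coarse form. The boundary values are controlled by point
evaluation. -/
theorem exists_spec_halfSeq_le {p : ℝ} (hp1 : 1 < p) (hp2 : p < 2) : ∃ c : ℝ, 0 < c ∧
    ∀ (nh N : ℕ), (nh = 2 * N + 1 ∨ nh = 2 * N) → ∀ x : ℕ → ℝ,
      spec p nh (halfSeq x) ≤ c * spec p (N + 1) x := by
  obtain ⟨c, hc, hcoef⟩ := exists_sq_le_spec hp1 hp2
  have hp0 : 0 < p := by linarith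
  have hκ := levyConst_pos hp0 hp2
  refine ⟨3 * (2 ^ p + 4 * levyConst p * c), by positivity, fun nh N hnh x => ?_⟩
  have hG := integrable_symbol_trigPoly hp0 hp2 (N + 1) x
  have hG2 := (integrable_comp_mul_left_iff (fun θ => symbol p θ * ‖trigPoly (N + 1) x θ‖ ^ 2)
    two_ne_zero).2 hG
  have hG3 := Measure.integral_comp_mul_left
    (fun θ => symbol p θ * ‖trigPoly (N + 1) x θ‖ ^ 2) 2
  have hle : spec p nh (halfSeq x) ≤ ∫ θ, (3 * (2 ^ (1 + p) *
      (symbol p (2 * θ) * ‖trigPoly (N + 1) x (2 * θ)‖ ^ 2))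
        + 3 * (x 0 ^ 2 + x N ^ 2) * symbol p θ) := by
    refine integral_mono (integrable_symbol_trigPoly hp0 hp2 _ _)
      (((hG2.const_mul _).const_mul _).add ((integrable_symbol hp0 hp2).const_mul _)) fun θ => ?_
    have h1 := mul_le_mul_of_nonneg_left (norm_sq_trigPoly_halfSeq_le hnh x θ)
      (symbol_nonneg p θ)
    have h2 : symbol p θ * (2 * (1 + Real.cos θ)) = 2 ^ (1 + p) * symbol p (2 * θ) := by
      simp only [symbol]
      rw [abs_mul, Real.mul_rpow (abs_nonneg _) (abs_nonneg _), abs_two]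
      have h3 : (2 : ℝ) ^ (1 + p) * 2 ^ (-1 - p) = 1 := by
        rw [← Real.rpow_add two_pos]; ring_nf; simp
      rw [Real.cos_two_mul]
      linear_combination (-2 * (1 - (2 * Real.cos θ ^ 2 - 1)) * |θ| ^ (-1 - p)) * h3
    dsimp only
    refine h1.trans (le_of_eq ?_)
    linear_combination 3 * ‖trigPoly (N + 1) x (2 * θ)‖ ^ 2 * h2
  refine hle.trans ?_
  rw [integral_add ((hG2.const_mul _).const_mul _) ((integrable_symbol hp0 hp2).const_mul _),
    integral_const_mul, integral_const_mul, integral_const_mul, hG3, integral_symbol]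
  have h0 := hcoef (N + 1) 0 (by omega) x
  have hN := hcoef (N + 1) N (by omega) x
  have h5 : (2 : ℝ) ^ (1 + p) = 2 * 2 ^ p := by rw [Real.rpow_add two_pos, Real.rpow_one]
  have h6 : |(2 : ℝ)⁻¹| = 1 / 2 := by rw [abs_of_pos (by norm_num)]; norm_num
  rw [h5, h6, smul_eq_mul]
  change 3 * (2 * 2 ^ p * (1 / 2 * spec p (N + 1) x)) + _ ≤ _
  nlinarith

theorem spec_neg (p : ℝ) (n : ℕ) (x : ℕ → ℝ) : spec p n (fun k => -x k) = spec p n x := by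
  have : ∀ θ, trigPoly n (fun k => -x k) θ = -trigPoly n x θ := by
    intro θ; simp [trigPoly]
  simp only [spec, this, norm_neg]

theorem trigPoly_truncate {n N : ℕ} (h : n ≤ N) (x : ℕ → ℝ) (θ : ℝ) :
    trigPoly N (fun k => if k < n then x k else 0) θ = trigPoly n x θ := by
  unfold trigPoly
  symm
  refine (sum_congr rfl fun k hk => ?_).trans (sum_subset (range_mono h) ?_)
  · simp only [if_pos (mem_range.1 hk)]
  · intro k _ hk
    simp [show ¬ k < n by simpa using hk]

/-- Duality on the half grid. The data norm stays on the full range `N` while the sum stops at any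
`n ≤ N`, as the maximum over `n` requires. -/
theorem exists_neg_sum_mul_le {p : ℝ} (hp1 : 1 < p) (hp2 : p < 2) : ∃ c : ℝ, 0 < c ∧
    ∀ (nh N n : ℕ), 1 ≤ N → n ≤ N → (nh = 2 * N + 1 ∨ nh = 2 * N) → ∀ (x q : ℕ → ℝ) (η : ℝ),
      0 < η → -∑ m ∈ Icc 1 n, x m * q m
        ≤ η * spec p (n + 1) x + c / η * low p nh (halfSeq q) := by
  obtain ⟨c₁, hc₁, hcoef⟩ := exists_sq_le_spec hp1 hp2
  obtain ⟨c₂, hc₂, hhalf⟩ := exists_spec_halfSeq_le hp1 hp2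
  have hκ := levyConst_pos (by linarith) hp2
  refine ⟨2 * c₂ + levyConst p * c₁, by positivity, fun nh N n hN hn hnh x q η hη => ?_⟩
  -- Truncating `x`, not `q`, leaves `spec` unchanged and avoids comparing `low` of `q` with `low`
  -- of its truncation.
  set x' : ℕ → ℝ := fun k => if k < n + 1 then x k else 0 with hx'
  set S := spec p (n + 1) x with hS
  set L := low p nh (halfSeq q) with hL
  have hSx : spec p (N + 1) x' = S := by
    simp only [hS, spec, hx', trigPoly_truncate (show n + 1 ≤ N + 1 by omega)]
  have hL0 : 0 ≤ L := low_nonneg _ _ _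
  have hS0 : 0 ≤ S := spec_nonneg _ _ _
  have hsum : ∑ m ∈ range (N + 1), x' m * q m = x 0 * q 0 + ∑ m ∈ Icc 1 n, x m * q m := by
    rw [← Finset.sum_subset (range_mono (show n + 1 ≤ N + 1 by omega))
      (fun k _ hk => by simp only [hx', if_neg (mt mem_range.2 hk), zero_mul])]
    rw [range_eq_Ico, sum_eq_sum_Ico_succ_bot (by omega)]
    have : Ico (0 + 1) (n + 1) = Icc 1 n := by ext; simp
    rw [this]
    congr 1
    refine sum_congr rfl fun k hk => ?_
    have := (mem_Icc.1 hk).2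
    simp only [hx']; rw [if_pos (by omega)]
  have hx0 : x' 0 = x 0 := by simp [hx']
  have h1 := mul_sum_halfSeq (fun k => x' k * q k) 1 N
  simp only [one_pow, mul_one, one_mul] at h1
  have h2 : ∀ k, halfSeq (fun k => x' k * q k) k = halfSeq x' k * halfSeq q k := fun k => rfl
  simp only [h2] at h1
  have hx0S : x' 0 ^ 2 ≤ c₁ * S := hSx ▸ hcoef (N + 1) 0 (by omega) x'
  have hxNS : x' N ^ 2 ≤ c₁ * S := hSx ▸ hcoef (N + 1) N (by omega) x'
  have hq0L : q 0 ^ 2 ≤ levyConst p * L := by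
    simpa [halfSeq] using sq_le_low hp1 hp2 (n := nh) (k := 0) (by omega) (halfSeq q)
  -- The left half `2 N - 1` of cell `N` is present for both values of `nh`.
  have hqNL : q N ^ 2 ≤ levyConst p * L := by
    have := sq_le_low hp1 hp2 (n := nh) (k := 2 * N - 1) (by omega) (halfSeq q)
    have h3 : halfSeq q (2 * N - 1) = q N := by unfold halfSeq; congr 1; omega
    rwa [h3] at this
  have young : ∀ a b : ℝ, a ^ 2 ≤ c₁ * S → b ^ 2 ≤ levyConst p * L → ∀ e : ℝ, e = 1 ∨ e = -1 →
      e * (a * b) ≤ η / 2 * S + levyConst p * c₁ / (2 * η) * L := by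
    intro a b ha hb e he
    have h5 : η / 2 * S + levyConst p * c₁ / (2 * η) * L
        = η / (2 * c₁) * (c₁ * S) + c₁ / (2 * η) * (levyConst p * L) := by field_simp
    have h6 : η / (2 * c₁) * a ^ 2 ≤ η / (2 * c₁) * (c₁ * S) := by gcongr
    have h7 : c₁ / (2 * η) * b ^ 2 ≤ c₁ / (2 * η) * (levyConst p * L) := by gcongr
    have h8 : η / (2 * c₁) * a ^ 2 + c₁ / (2 * η) * b ^ 2 - e * (a * b)
        = η / (2 * c₁) * (a - e * c₁ / η * b) ^ 2 := by
      rcases he with rfl | rfl <;> (field_simp; ring)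
    have h9 : 0 ≤ η / (2 * c₁) * (a - e * c₁ / η * b) ^ 2 := by positivity
    linarith
  have hpair : -∑ k ∈ range nh, halfSeq x' k * halfSeq q k ≤ η / 2 * S + 2 * c₂ / η * L := by
    have h5 := pairing_le hp1 hp2 nh (fun k => -halfSeq x' k) (halfSeq q) (η := η / c₂)
      (by positivity)
    rw [spec_neg] at h5
    have h6 := hhalf nh N hnh x'
    rw [hSx] at h6
    simp only [neg_mul, sum_neg_distrib] at h5
    have h7 : η / c₂ / 2 * spec p nh (halfSeq x') ≤ η / 2 * S := by
      calc _ ≤ η / c₂ / 2 * (c₂ * S) := by gcongr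
        _ = _ := by field_simp
    have hpi := Real.pi_gt_three
    have hpi2 : Real.pi ^ 2 ≤ 16 := by nlinarith [Real.pi_le_four]
    have h8 : Real.pi ^ 2 / (8 * (η / c₂)) * L ≤ 2 * c₂ / η * L := by
      refine mul_le_mul_of_nonneg_right ?_ hL0
      rw [div_le_div_iff₀ (by positivity) hη]
      have : 2 * c₂ * (8 * (η / c₂)) = 16 * η := by field_simp; norm_num
      rw [this]; gcongr
    have hR : 0 ≤ η / 2 * S + 2 * c₂ / η * L := by positivity
    set P := -∑ k ∈ range nh, halfSeq x' k * halfSeq q k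
    nlinarith
  have hfin : (2 * c₂ + levyConst p * c₁) / η * L
      = 2 * c₂ / η * L + 2 * (levyConst p * c₁ / (2 * η) * L) := by field_simp
  have hpos : 0 ≤ 2 * c₂ / η * L := by positivity
  have hpos2 : 0 ≤ levyConst p * c₁ / (2 * η) * L := by positivity
  have hpos3 : 0 ≤ η * S := by positivity
  have y0 := young (x' 0) (q 0) hx0S hq0L 1 (Or.inl rfl)
  rw [hx0] at y0 h1
  rw [hfin]
  rcases hnh with h | h
  · rw [h] at hpair
    linarith
  · rw [sum_range_succ, halfSeq_two_mul, halfSeq_two_mul, ← h] at h1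
    have yN := young (x' N) (q N) hxNS hqNL (-1) (Or.inr rfl)
    linarith

/-- Coercivity of the discrete damping term, for one component. -/
theorem exists_damping_ge {α : ℝ} (hα₀ : 0 < α) (hα₁ : α < 1) {c₀ : ℝ} (hc₀ : 0 < c₀) :
    ∃ c : ℝ, 0 < c ∧ ∀ (nh N n : ℕ), 1 ≤ N → n ≤ N → (nh = 2 * N + 1 ∨ nh = 2 * N) →
      ∀ (τ : ℝ) (x q : ℕ → ℝ), 0 < τ →
      (galerkinCoeff α τ 0 * x 0) ^ 2 ≤ c₀ * low (2 - α) nh (halfSeq q) →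
      galerkinCoeff α τ 0 / (4 * levyConst (2 - α)) * spec (2 - α) (n + 1) x
          - c / galerkinCoeff α τ 0 * low (2 - α) nh (halfSeq q)
        ≤ ∑ m ∈ Icc 1 n, x m * (∑ j ∈ range (m + 1), galerkinCoeff α τ j * x (m - j) + q m) := by
  obtain ⟨c₁, hc₁, hpair⟩ := exists_neg_sum_mul_le (p := 2 - α) (by linarith) (by linarith)
  have hκ := levyConst_pos (p := 2 - α) (by linarith) (by linarith)
  refine ⟨4 * levyConst (2 - α) * c₁ + c₀, by positivity, fun nh N n hN hn hnh τ x q hτ h0 => ?_⟩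
  have hA := galerkinCoeff_zero_pos hα₁ hτ
  have hs := sum_galerkinCoeff_mul hα₀ hα₁ τ (n + 1) x
  rw [range_eq_Ico, sum_eq_sum_Ico_succ_bot (by omega)] at hs
  have hI : Ico (0 + 1) (n + 1) = Icc 1 n := by ext; simp
  rw [hI] at hs
  simp only [zero_add, range_one, sum_singleton, Nat.sub_zero] at hs
  -- The full form equals `A / (2 κ) * S`; this `η` spends half of it on the correction.
  have hq := hpair nh N n hN hn hnh x q (galerkinCoeff α τ 0 / (4 * levyConst (2 - α)))
    (by positivity)
  simp only [mul_add, sum_add_distrib]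
  set A := galerkinCoeff α τ 0
  set κ := levyConst (2 - α)
  set S := spec (2 - α) (n + 1) x
  set L := low (2 - α) nh (halfSeq q)
  set G := ∑ m ∈ Icc 1 n, x m * ∑ j ∈ range (m + 1), galerkinCoeff α τ j * x (m - j)
  have e1 : x 0 * (A * x 0) + G = A / (2 * κ) * S := by field_simp; linarith
  have e2 : c₁ / (A / (4 * κ)) * L = 4 * κ * c₁ / A * L := by field_simp
  -- The `m = 0` term, which belongs to the positive form but not to the sum from `1`, is paid for
  -- by the correction.
  have e3 : x 0 * (A * x 0) ≤ c₀ / A * L := by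
    have : x 0 * (A * x 0) = (A * x 0) ^ 2 / A := by field_simp
    rw [this, div_mul_eq_mul_div]
    gcongr
  have e4 : (4 * κ * c₁ + c₀) / A * L = 4 * κ * c₁ / A * L + c₀ / A * L := by ring
  have e5 : A / (2 * κ) * S = 2 * (A / (4 * κ) * S) := by field_simp; ring
  rw [e2] at hq
  rw [e4]
  linarith

/-! ### Sobolev norms of step functions -/

theorem norm_sq_exp_sub_one (t : ℝ) :
    ‖Complex.exp (-((t : ℝ) : ℂ) * Complex.I) - 1‖ ^ 2 = 2 * (1 - Real.cos t) := by
  rw [exp_neg_mul_I, Complex.sq_norm, Complex.normSq_apply]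
  simp only [Complex.sub_re, Complex.one_re, Complex.sub_im, Complex.one_im]
  linear_combination Real.cos_sq_add_sin_sq t

/-- The Fourier transform of a step function on a uniform grid. -/
theorem norm_sq_fourierZeroExt {h : ℝ} (hh : 0 < h) (n : ℕ) (y : ℕ → ℝ) {g : ℝ → ℝ}
    (hg : ∀ k < n, ∀ x ∈ Set.Ioo (k * h) ((k + 1) * h), g x = y k) {ω : ℝ} (hω : ω ≠ 0) :
    ‖fourierZeroExt (n * h) g ω‖ ^ 2 = 1 / (2 * Real.pi) *
      (2 * (1 - Real.cos (h * ω)) / ω ^ 2 * ‖trigPoly n y (h * ω)‖ ^ 2) := by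
  set F : ℝ → ℂ := fun x => Complex.exp (-((ω * x : ℝ) : ℂ) * Complex.I) * ((g x : ℝ) : ℂ) with hF
  set c : ℂ := -(ω : ℂ) * Complex.I with hc
  have hc0 : c ≠ 0 := by simp [hc, hω]
  have hae : ∀ k < n, ∀ᵐ x : ℝ, x ∈ Set.uIoc ((k : ℝ) * h) (((k + 1 : ℕ) : ℝ) * h) →
      (y k : ℂ) * Complex.exp (c * x) = F x := by
    intro k hk
    have h0 : ∀ᵐ x : ℝ, x ≠ ((k + 1 : ℕ) : ℝ) * h := by simp [ae_iff, measure_singleton]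
    filter_upwards [h0] with x hx hxm
    rw [Set.uIoc_of_le (by push_cast; nlinarith)] at hxm
    have : g x = y k := hg k hk x ⟨hxm.1, by
      have := lt_of_le_of_ne hxm.2 hx; push_cast at this; exact this⟩
    simp only [hF, this, hc]
    rw [mul_comm]
    congr 2
    push_cast; ring
  have hint : ∀ k < n, IntervalIntegrable F volume ((fun k : ℕ => (k : ℝ) * h) k)
      ((fun k : ℕ => (k : ℝ) * h) (k + 1)) := by
    intro k hk
    have : IntervalIntegrable (fun x : ℝ => (y k : ℂ) * Complex.exp (c * x)) volume
        ((k : ℝ) * h) (((k + 1 : ℕ) : ℝ) * h) := by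
      apply Continuous.intervalIntegrable; fun_prop
    refine this.congr_ae ?_
    exact (ae_restrict_iff' measurableSet_uIoc).2 (hae k hk)
  have hsum := intervalIntegral.sum_integral_adjacent_intervals hint
  simp only [Nat.cast_zero, zero_mul] at hsum
  have hpiece : ∀ k ∈ range n, ∫ x in ((k : ℝ) * h)..(((k + 1 : ℕ) : ℝ) * h), F x
      = (Complex.exp (-((h * ω : ℝ) : ℂ) * Complex.I) - 1) / c *
        ((y k : ℂ) * Complex.exp (-((k * (h * ω) : ℝ) : ℂ) * Complex.I)) := by
    intro k hk
    rw [← intervalIntegral.integral_congr_ae (hae k (mem_range.1 hk)),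
      intervalIntegral.integral_const_mul, integral_exp_mul_complex hc0]
    have e1 : Complex.exp (c * ((((k + 1 : ℕ) : ℝ) * h : ℝ) : ℂ))
        = Complex.exp (-((k * (h * ω) : ℝ) : ℂ) * Complex.I)
          * Complex.exp (-((h * ω : ℝ) : ℂ) * Complex.I) := by
      rw [← Complex.exp_add]; congr 1; simp only [hc]; push_cast; ring
    have e2 : Complex.exp (c * (((k : ℝ) * h : ℝ) : ℂ))
        = Complex.exp (-((k * (h * ω) : ℝ) : ℂ) * Complex.I) := by
      congr 1; simp only [hc]; push_cast; ring
    rw [e1, e2]; ring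
  have hval : fourierZeroExt (n * h) g ω = (1 / Real.sqrt (2 * Real.pi) : ℝ) *
      ((Complex.exp (-((h * ω : ℝ) : ℂ) * Complex.I) - 1) / c * trigPoly n y (h * ω)) := by
    rw [fourierZeroExt, trigPoly, mul_sum, ← sum_congr rfl hpiece]
    congr 1
    exact hsum.symm
  have hcn : ‖c‖ ^ 2 = ω ^ 2 := by simp [hc]
  rw [hval, norm_mul, norm_mul, norm_div, mul_pow, mul_pow, div_pow, norm_sq_exp_sub_one, hcn,
    Complex.norm_real, Real.norm_eq_abs, sq_abs, div_pow, Real.sq_sqrt (by positivity)]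
  ring

/-- The contribution of one component to `sobolevNormSq`. -/
def sobolevScalar (σ t : ℝ) (g : ℝ → ℝ) : ℝ :=
  ∫ ω : ℝ, (1 + ω ^ 2) ^ σ * ‖fourierZeroExt t g ω‖ ^ 2

theorem sobolevScalar_nonneg (σ t : ℝ) (g : ℝ → ℝ) : 0 ≤ sobolevScalar σ t g :=
  integral_nonneg fun ω => by positivity

/-- For a negative exponent the inhomogeneous weight is at most the homogeneous one, and the latter
turns `|𝓕 g|²` into the symbol after `θ = h ω`. -/
theorem sobolevScalar_neg_le {p h : ℝ} (hp1 : 1 < p) (hp2 : p < 2) (hh : 0 < h) (n : ℕ)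
    (y : ℕ → ℝ) {g : ℝ → ℝ} (hg : ∀ k < n, ∀ x ∈ Set.Ioo (k * h) ((k + 1) * h), g x = y k) :
    sobolevScalar (-((p - 1) / 2)) (n * h) g ≤ 1 / (2 * Real.pi) * h ^ p * spec p n y := by
  have hG := (integrable_comp_mul_left_iff (fun θ => symbol p θ * ‖trigPoly n y θ‖ ^ 2)
    hh.ne').2 (integrable_symbol_trigPoly (by linarith) hp2 n y)
  have hG2 := Measure.integral_comp_mul_left (fun θ => symbol p θ * ‖trigPoly n y θ‖ ^ 2) h
  have hle : sobolevScalar (-((p - 1) / 2)) (n * h) g ≤ ∫ ω, 1 / (2 * Real.pi) * h ^ (1 + p) *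
      (symbol p (h * ω) * ‖trigPoly n y (h * ω)‖ ^ 2) := by
    refine integral_mono_of_nonneg (Filter.Eventually.of_forall fun ω => by positivity)
      (hG.const_mul _) ?_
    filter_upwards [ae_ne_zero] with ω hω
    have hω' : 0 < |ω| := abs_pos.2 hω
    rw [norm_sq_fourierZeroExt hh n y hg hω]
    have h1 : (1 + ω ^ 2) ^ (-((p - 1) / 2)) ≤ |ω| ^ (1 - p) := by
      calc (1 + ω ^ 2) ^ (-((p - 1) / 2)) ≤ (|ω| ^ 2) ^ (-((p - 1) / 2)) := by
            refine Real.rpow_le_rpow_of_nonpos (by positivity) ?_ (by linarith)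
            rw [sq_abs]; linarith
        _ = _ := by
            rw [← Real.rpow_natCast, ← Real.rpow_mul (abs_nonneg _)]
            congr 1; push_cast; ring
    have h2 : |ω| ^ (1 - p) * (1 / ω ^ 2) = h ^ (1 + p) * |h * ω| ^ (-1 - p) := by
      rw [abs_mul, abs_of_pos hh, Real.mul_rpow hh.le (abs_nonneg _), ← mul_assoc,
        ← Real.rpow_add hh, show (1 + p + (-1 - p)) = 0 by ring, Real.rpow_zero, one_mul,
        ← sq_abs ω, ← Real.rpow_two, one_div, ← Real.rpow_neg (abs_nonneg _), ← Real.rpow_add hω']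
      ring_nf
    have h3 : 0 ≤ 1 - Real.cos (h * ω) := by linarith [Real.cos_le_one (h * ω)]
    calc _ ≤ |ω| ^ (1 - p) * (1 / (2 * Real.pi) *
          (2 * (1 - Real.cos (h * ω)) / ω ^ 2 * ‖trigPoly n y (h * ω)‖ ^ 2)) := by gcongr
      _ = (|ω| ^ (1 - p) * (1 / ω ^ 2)) * (1 / (2 * Real.pi) *
          (2 * (1 - Real.cos (h * ω)) * ‖trigPoly n y (h * ω)‖ ^ 2)) := by ring
      _ = _ := by rw [h2, symbol]; ring
  refine hle.trans (le_of_eq ?_)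
  rw [integral_const_mul, hG2, abs_of_pos (by positivity), smul_eq_mul, Real.rpow_add hh,
    Real.rpow_one, spec]
  field_simp

/-- Needed because a divergent integral would take the default value `0`, and the norm could then
not serve as an upper bound. The integrand decays like `|ω| ^ (p - 3)`, with `p < 2`. -/
theorem integrable_sobolev {p h : ℝ} (hp2 : p < 2) (hh : 0 < h) (n : ℕ)
    (y : ℕ → ℝ) {g : ℝ → ℝ} (hg : ∀ k < n, ∀ x ∈ Set.Ioo (k * h) ((k + 1) * h), g x = y k) :
    Integrable fun ω : ℝ => (1 + ω ^ 2) ^ ((p - 1) / 2) * ‖fourierZeroExt (n * h) g ω‖ ^ 2 := by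
  set B := (∑ k ∈ range n, |y k|) ^ 2
  set F : ℝ → ℝ := fun ω => (1 + ω ^ 2) ^ ((p - 1) / 2) * (1 / (2 * Real.pi) *
      (2 * (1 - Real.cos (h * ω)) / ω ^ 2 * ‖trigPoly n y (h * ω)‖ ^ 2)) with hF
  have hmeas : Measurable F := by
    have h1 : Measurable fun ω : ℝ => (1 + ω ^ 2) ^ ((p - 1) / 2) :=
      (by fun_prop : Measurable fun ω : ℝ => 1 + ω ^ 2).pow_const _
    have h2 : Measurable fun ω : ℝ => ‖trigPoly n y (h * ω)‖ ^ 2 :=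
      (by fun_prop : Continuous fun ω : ℝ => ‖trigPoly n y (h * ω)‖ ^ 2).measurable
    have h3 : Measurable fun ω : ℝ => 2 * (1 - Real.cos (h * ω)) / ω ^ 2 := by fun_prop
    exact h1.mul ((h3.mul h2).const_mul _)
  have hbound : Integrable fun ω : ℝ => 1 / (2 * Real.pi) * (2 * (h ^ 2 / 2 + 2)) * B *
      (1 + ‖ω‖ ^ 2) ^ (-(3 - p) / 2) := by
    refine (integrable_rpow_neg_one_add_norm_sq (r := 3 - p) ?_).const_mul _
    simp; linarith
  have hFint : Integrable F := by
    refine hbound.mono' hmeas.aestronglyMeasurable ?_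
    filter_upwards [ae_ne_zero] with ω hω
    have h3 : 0 ≤ 1 - Real.cos (h * ω) := by linarith [Real.cos_le_one (h * ω)]
    rw [Real.norm_of_nonneg (by positivity), Real.norm_eq_abs, sq_abs]
    have hw : 0 < 1 + ω ^ 2 := by positivity
    have h4 : (1 + ω ^ 2) ^ ((p - 1) / 2) = (1 + ω ^ 2) ^ (-(3 - p) / 2) * (1 + ω ^ 2) := by
      nth_rewrite 3 [← Real.rpow_one (1 + ω ^ 2)]
      rw [← Real.rpow_add hw]; ring_nf
    -- The summand `h ^ 2 / 2` comes from the quadratic bound for `1 - cos`, the summand `2` from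
    -- the trivial one.
    have h5 : (1 + ω ^ 2) * ((1 - Real.cos (h * ω)) / ω ^ 2) ≤ h ^ 2 / 2 + 2 := by
      have hω2 : 0 < ω ^ 2 := by positivity
      rw [mul_div_assoc', div_le_iff₀ hω2]
      have := Real.one_sub_sq_div_two_le_cos (x := h * ω)
      have := Real.neg_one_le_cos (h * ω)
      nlinarith
    have h6 : ‖trigPoly n y (h * ω)‖ ^ 2 ≤ B :=
      (le_abs_self _).trans (abs_norm_sq_trigPoly_le n y _)
    simp only [hF]
    rw [h4]
    calc _ = 1 / (2 * Real.pi) * (2 * ((1 + ω ^ 2) * ((1 - Real.cos (h * ω)) / ω ^ 2))) *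
          ‖trigPoly n y (h * ω)‖ ^ 2 * (1 + ω ^ 2) ^ (-(3 - p) / 2) := by ring
      _ ≤ _ := by gcongr
  refine hFint.congr ?_
  filter_upwards [ae_ne_zero] with ω hω
  rw [norm_sq_fourierZeroExt hh n y hg hω]

/-- For a positive exponent the inhomogeneous weight is at least the homogeneous one. Only the
frequencies `|h ω| ≤ π` are kept, where `1 - cos` is bounded below quadratically. -/
theorem low_le_sobolevScalar {p h : ℝ} (hp1 : 1 < p) (hp2 : p < 2) (hh : 0 < h) (n : ℕ)
    (y : ℕ → ℝ) {g : ℝ → ℝ} (hg : ∀ k < n, ∀ x ∈ Set.Ioo (k * h) ((k + 1) * h), g x = y k) :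
    low p n y ≤ Real.pi ^ 3 / 2 * h ^ (p - 2) * sobolevScalar ((p - 1) / 2) (n * h) g := by
  set F : ℝ → ℝ := fun ω =>
    (1 + ω ^ 2) ^ ((p - 1) / 2) * ‖fourierZeroExt (n * h) g ω‖ ^ 2 with hF
  have hFint : Integrable F := integrable_sobolev hp2 hh n y hg
  have hG := (integrable_comp_mul_left_iff F (inv_ne_zero hh.ne')).2 hFint
  have hG2 := Measure.integral_comp_mul_left F h⁻¹
  have hpi := Real.pi_pos
  calc low p n y ≤ ∫ θ in Set.Icc (-Real.pi) Real.pi,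
        Real.pi ^ 3 / 2 * h ^ (p - 3) * F (h⁻¹ * θ) := by
        refine setIntegral_mono_on_ae (integrableOn_low hp1.le n y) (hG.const_mul _).integrableOn
          measurableSet_Icc ?_
        filter_upwards [ae_ne_zero] with θ hθ hθ2
        have hθ' : 0 < |θ| := abs_pos.2 hθ
        have hωne : h⁻¹ * θ ≠ 0 := mul_ne_zero (inv_ne_zero hh.ne') hθ
        simp only [hF]
        rw [norm_sq_fourierZeroExt hh n y hg hωne, mul_inv_cancel_left₀ hh.ne']
        have h1 : h ^ (1 - p) * |θ| ^ (p - 1) ≤ (1 + (h⁻¹ * θ) ^ 2) ^ ((p - 1) / 2) := by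
          calc h ^ (1 - p) * |θ| ^ (p - 1) = ((h⁻¹ * |θ|) ^ 2) ^ ((p - 1) / 2) := by
                rw [← Real.rpow_natCast, ← Real.rpow_mul (by positivity),
                  Real.mul_rpow (by positivity) (by positivity), Real.inv_rpow hh.le,
                  ← Real.rpow_neg hh.le]
                congr 2 <;> (push_cast; ring)
            _ ≤ _ := by
                refine Real.rpow_le_rpow (by positivity) ?_ (by linarith)
                rw [mul_pow, mul_pow, sq_abs]; linarith
        have h2 : 4 / Real.pi ^ 2 * h ^ 2 ≤ 2 * (1 - Real.cos θ) / (h⁻¹ * θ) ^ 2 := by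
          have := Real.cos_le_one_sub_mul_cos_sq (abs_le.2 hθ2)
          rw [le_div_iff₀ (by positivity)]
          have e : 4 / Real.pi ^ 2 * h ^ 2 * (h⁻¹ * θ) ^ 2 = 2 * (2 / Real.pi ^ 2 * θ ^ 2) := by
            field_simp; norm_num
          rw [e]; linarith
        have h3 : h ^ (p - 3) * (h ^ (1 - p) * h ^ 2) = 1 := by
          rw [← Real.rpow_two, ← Real.rpow_add hh, ← Real.rpow_add hh]; ring_nf; simp
        calc |θ| ^ (p - 1) * ‖trigPoly n y θ‖ ^ 2
            = (h ^ (p - 3) * (h ^ (1 - p) * h ^ 2)) * (|θ| ^ (p - 1) * ‖trigPoly n y θ‖ ^ 2) := by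
              rw [h3, one_mul]
          _ = Real.pi ^ 3 / 2 * h ^ (p - 3) * ((h ^ (1 - p) * |θ| ^ (p - 1)) *
              (1 / (2 * Real.pi) * (4 / Real.pi ^ 2 * h ^ 2 * ‖trigPoly n y θ‖ ^ 2))) := by
              field_simp; norm_num
          _ ≤ _ := by gcongr
    _ ≤ ∫ θ, Real.pi ^ 3 / 2 * h ^ (p - 3) * F (h⁻¹ * θ) := by
        refine setIntegral_le_integral (hG.const_mul _) (Filter.Eventually.of_forall fun θ => ?_)
        simp only [hF]; positivity
    _ = _ := by
        rw [integral_const_mul, hG2, inv_inv, abs_of_pos hh, smul_eq_mul, sobolevScalar]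
        have : h ^ (p - 2) = h ^ (p - 3) * h := by
          rw [← Real.rpow_add_one hh.ne']; ring_nf
        rw [this]; ring

/-! ### The cells of the time grid as unions of half cells -/

/-- One component of `stepFun`. -/
def stepReal (T : ℝ) (J : ℕ) (x : ℕ → ℝ) (t : ℝ) : ℝ :=
  ∑ n ∈ range (J + 1), (Set.Icc (cellLeft T J n) (cellRight T J n)).indicator (fun _ => x n) t

/-- The number of half cells in `(0, t̂_{N+})`. -/
def halfCount (J N : ℕ) : ℕ := if N = J then 2 * N else 2 * N + 1

theorem halfCount_eq (J N : ℕ) : halfCount J N = 2 * N + 1 ∨ halfCount J N = 2 * N := by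
  unfold halfCount; split_ifs <;> simp

theorem halfCount_le {J N : ℕ} (h : N ≤ J) : halfCount J N ≤ 2 * J := by
  unfold halfCount; split_ifs <;> omega

theorem cellRight_eq (T : ℝ) {J : ℕ} (hJ : 1 ≤ J) (N : ℕ) :
    cellRight T J N = (halfCount J N : ℝ) * (T / J / 2) := by
  have hJ' : (J : ℝ) ≠ 0 := by positivity
  unfold cellRight halfCount
  split_ifs with h
  · rw [h]; push_cast; field_simp
  · push_cast; field_simp

/-- Truncated subtraction makes the formula valid at `i = 0` as well. -/
theorem cellLeft_eq (T : ℝ) {J : ℕ} (i : ℕ) :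
    cellLeft T J i = ((2 * i - 1 : ℕ) : ℝ) * (T / J / 2) := by
  unfold cellLeft
  split_ifs with h
  · simp [h]
  · rw [Nat.cast_sub (by omega)]; push_cast; ring

/-- The open half cell avoids the endpoints, where closed neighbouring cells overlap and their
values add up. -/
theorem stepReal_eq {T : ℝ} (hT : 0 < T) {J : ℕ} (hJ : 1 ≤ J) (x : ℕ → ℝ) {k : ℕ}
    (hk : k < 2 * J) {t : ℝ} (ht : t ∈ Set.Ioo (k * (T / J / 2)) ((k + 1) * (T / J / 2))) :
    stepReal T J x t = halfSeq x k := by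
  have hh : 0 < T / J / 2 := by positivity
  set h := T / J / 2
  have hmem : ∀ n ≤ J, t ∈ Set.Icc (cellLeft T J n) (cellRight T J n) ↔ n = (k + 1) / 2 := by
    intro n hn
    rw [Set.mem_Icc, cellLeft_eq, cellRight_eq T hJ]
    constructor
    · rintro ⟨h1, h2⟩
      have h3 : ((2 * n - 1 : ℕ) : ℝ) < ((k + 1 : ℕ) : ℝ) := by
        push_cast; exact lt_of_mul_lt_mul_right (h1.trans_lt ht.2) hh.le
      have h4 : ((k : ℕ) : ℝ) < ((halfCount J n : ℕ) : ℝ) :=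
        lt_of_mul_lt_mul_right (ht.1.trans_le h2) hh.le
      rw [Nat.cast_lt] at h3 h4
      have := halfCount_eq J n
      omega
    · intro h1
      have h3 : ((2 * n - 1 : ℕ) : ℝ) ≤ ((k : ℕ) : ℝ) := by
        rw [Nat.cast_le]; omega
      have h4 : ((k + 1 : ℕ) : ℝ) ≤ ((halfCount J n : ℕ) : ℝ) := by
        rw [Nat.cast_le]; unfold halfCount; split_ifs <;> omega
      push_cast at h4
      exact ⟨(mul_le_mul_of_nonneg_right h3 hh.le).trans ht.1.le,
        ht.2.le.trans (mul_le_mul_of_nonneg_right h4 hh.le)⟩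
  unfold stepReal
  rw [sum_eq_single ((k + 1) / 2)]
  · rw [Set.indicator_of_mem ((hmem _ (by omega)).2 rfl)]; rfl
  · intro n hn hne
    have := mem_range.1 hn
    exact Set.indicator_of_notMem (fun h => hne ((hmem n (by omega)).1 h)) _
  · intro h; exact absurd (mem_range.2 (by omega)) h

theorem sobolevScalar_stepReal_le {α T : ℝ} (hα₀ : 0 < α) (hα₁ : α < 1) (hT : 0 < T) {J N : ℕ}
    (hJ : 1 ≤ J) (hN : N ≤ J) (x : ℕ → ℝ) :
    sobolevScalar (-(1 - α) / 2) (cellRight T J N) (stepReal T J x)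
      ≤ 1 / (2 * Real.pi) * (T / J / 2) ^ (2 - α)
        * spec (2 - α) (halfCount J N) (halfSeq x) := by
  rw [cellRight_eq T hJ, show -(1 - α) / 2 = -((2 - α - 1) / 2) by ring]
  exact sobolevScalar_neg_le (by linarith) (by linarith) (by positivity) _ _ fun k hk t ht =>
    stepReal_eq hT hJ x (hk.trans_le (halfCount_le hN)) ht

theorem low_le_sobolevScalar_stepReal {α T : ℝ} (hα₀ : 0 < α) (hα₁ : α < 1) (hT : 0 < T)
    {J N : ℕ} (hJ : 1 ≤ J) (hN : N ≤ J) (x : ℕ → ℝ) :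
    low (2 - α) (halfCount J N) (halfSeq x) ≤ Real.pi ^ 3 / 2 * (T / J / 2) ^ (-α)
      * sobolevScalar ((1 - α) / 2) (cellRight T J N) (stepReal T J x) := by
  rw [cellRight_eq T hJ, show (1 - α) / 2 = (2 - α - 1) / 2 by ring,
    show -α = 2 - α - 2 by ring]
  exact low_le_sobolevScalar (by linarith) (by linarith) (by positivity) _ _ fun k hk t ht =>
    stepReal_eq hT hJ x (hk.trans_le (halfCount_le hN)) ht

/-! ### Recovery of the initial values from the corrections -/

/-- The hypotheses force `2 ^ p` to be the square of the golden ratio. A rational approximation of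
`log 3 / log 2` from above, `27 / 17`, then decides the inequality by integer arithmetic. -/
theorem rpow_three_lt {p : ℝ} (hp : 0 < p) (h : (2 : ℝ) ^ p * (2 : ℝ) ^ p = 3 * 2 ^ p - 1)
    (h2 : 2 < (2 : ℝ) ^ p) : (3 : ℝ) ^ p < 2 ^ p + 2 := by
  set x := (2 : ℝ) ^ p with hx
  have h3 : ((3 : ℝ) ^ p) ^ 17 < x ^ 27 := by
    have : ((3 : ℝ) ^ 17) ^ p < ((2 : ℝ) ^ 27) ^ p :=
      Real.rpow_lt_rpow (by norm_num) (by norm_num) hp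
    rwa [← Real.rpow_natCast_mul (by norm_num), mul_comm, Real.rpow_mul_natCast (by norm_num),
      ← Real.rpow_natCast_mul (by norm_num), mul_comm, Real.rpow_mul_natCast (by norm_num)] at this
  have hsq : x ^ 2 = 3 * x - 1 := by rw [sq]; exact h
  have cube : ∀ a b : ℝ, (a * x + b) ^ 3
      = (8 * a ^ 3 + 9 * a ^ 2 * b + 3 * a * b ^ 2) * x
        + (-3 * a ^ 3 - 3 * a ^ 2 * b + b ^ 3) := fun a b => by
    linear_combination (a ^ 3 * (x + 3) + 3 * a ^ 2 * b) * hsq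
  have square : ∀ a b : ℝ, (a * x + b) ^ 2 = (3 * a ^ 2 + 2 * a * b) * x + (b ^ 2 - a ^ 2) :=
    fun a b => by linear_combination a ^ 2 * hsq
  -- Powers reduce to linear polynomials modulo `x ^ 2 = 3 * x - 1`; here the coefficients are
  -- Fibonacci numbers.
  have hx27 : x ^ 27 = 86267571272 * x - 32951280099 := by
    rw [show x ^ 27 = (((1 * x + 0) ^ 3) ^ 3) ^ 3 by ring, cube, cube, cube]; ring
  have hy17 : (x + 2) ^ 17 = 88365044497 * x - 33749885557 := by
    rw [show (x + 2) ^ 17 = ((((1 * x + 2) ^ 2) ^ 2) ^ 2) ^ 2 * (x + 2) by ring, square, square,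
      square, square]
    linear_combination 19134543141 * hsq
  exact lt_of_pow_lt_pow_left₀ 17 (by positivity) (h3.trans_le (by rw [hx27, hy17]; linarith))

/-- The Galerkin coefficients normalized by the first one. -/
def galerkinRatio (α : ℝ) : ℕ → ℝ
  | 0 => 1
  | l + 1 => ((l : ℝ) + 2) ^ (2 - α) - 2 * ((l : ℝ) + 1) ^ (2 - α) + (l : ℝ) ^ (2 - α)

theorem galerkinCoeff_eq (α τ : ℝ) (l : ℕ) :
    galerkinCoeff α τ l = galerkinCoeff α τ 0 * galerkinRatio α l := by
  cases l with
  | zero => simp [galerkinRatio]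
  | succ l => rfl

/-- The first three consecutive pairs of Galerkin coefficients are not all proportional. -/
theorem galerkinRatio_nondegenerate {α : ℝ} (hα₁ : α < 1)
    (h : galerkinRatio α 1 * galerkinRatio α 1 = galerkinRatio α 2) :
    galerkinRatio α 1 * galerkinRatio α 2 ≠ galerkinRatio α 3 := by
  intro h3
  have hp : 0 < 2 - α := by linarith
  have h1' : galerkinRatio α 1 = 2 ^ (2 - α) - 2 := by
    simp [galerkinRatio, Real.zero_rpow hp.ne']
  have h2' : galerkinRatio α 2 = 3 ^ (2 - α) - 2 * 2 ^ (2 - α) + 1 := by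
    simp only [galerkinRatio]; norm_num
  have h3' : galerkinRatio α 3 = 4 ^ (2 - α) - 2 * 3 ^ (2 - α) + 2 ^ (2 - α) := by
    simp only [galerkinRatio]; norm_num
  have h4 : (4 : ℝ) ^ (2 - α) = 2 ^ (2 - α) * 2 ^ (2 - α) := by
    rw [← Real.mul_rpow (by norm_num) (by norm_num)]; norm_num
  have hx : 2 < (2 : ℝ) ^ (2 - α) := by
    nth_rewrite 1 [← Real.rpow_one 2]
    exact Real.rpow_lt_rpow_of_exponent_lt (by norm_num) (by linarith)
  have key := rpow_three_lt hp (p := 2 - α)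
  rw [h1', h2'] at h
  rw [h1', h2', h3', h4] at h3
  generalize (2 : ℝ) ^ (2 - α) = x at *
  generalize (3 : ℝ) ^ (2 - α) = y at *
  have hy : y = x ^ 2 - 2 * x + 3 := by linarith
  subst hy
  -- Both relations would make the ratios geometric, `1, r, r ^ 2, r ^ 3` with `r = x - 2`. The
  -- second factor then gives `y = x + 2`, against `rpow_three_lt`.
  have hfac : (x - 2) * (x ^ 2 - 3 * x + 1) = 0 := by linear_combination h3
  have hx2 : x ^ 2 - 3 * x + 1 = 0 := by
    rcases mul_eq_zero.1 hfac with h | h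
    · linarith
    · exact h
  have := key (by linarith) hx
  linarith

/-- The initial value `ṽ_0` is controlled by two of the initial corrections. -/
theorem exists_sq_le_initCorr {α : ℝ} (hα₁ : α < 1) : ∃ (c : ℝ), 0 < c ∧
    ∀ (τ : ℝ) (N : ℕ), 0 < τ → 1 ≤ N →
      (2 ≤ N ∨ galerkinCoeff α τ 1 ^ 2 ≠ galerkinCoeff α τ 0 * galerkinCoeff α τ 2) →
      ∃ k, 1 ≤ k ∧ k ≤ N ∧ ∀ (s a b : ℝ) (q : ℕ → ℝ), (s = 1 ∨ s = -1) →
        (∀ n, q n = 1 / 4 * (galerkinCoeff α τ (n + 1) * a + s * galerkinCoeff α τ n * b)) →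
        (galerkinCoeff α τ 0 * (1 / 2 * (b + a))) ^ 2 ≤ c * (q 0 ^ 2 + q k ^ 2) := by
  obtain ⟨k, hk1, hk2, hkne, hkN⟩ : ∃ k, 1 ≤ k ∧ k ≤ 2 ∧
      galerkinRatio α 1 * galerkinRatio α k - galerkinRatio α (k + 1) ≠ 0 ∧
      (galerkinRatio α 1 * galerkinRatio α 1 ≠ galerkinRatio α 2 → k = 1) := by
    by_cases h : galerkinRatio α 1 * galerkinRatio α 1 = galerkinRatio α 2
    · exact ⟨2, by norm_num, le_rfl, sub_ne_zero.2 (galerkinRatio_nondegenerate hα₁ h),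
        fun h' => absurd h h'⟩
    · exact ⟨1, le_rfl, by norm_num, sub_ne_zero.2 h, fun _ => rfl⟩
  set D := galerkinRatio α 1 * galerkinRatio α k - galerkinRatio α (k + 1) with hD
  set β₁ := galerkinRatio α 1
  set β := galerkinRatio α k
  -- Solution of the linear system: `β q_0 - q_k` eliminates `b` and yields `a`, then `q_0` yields
  -- `b`.
  set u : ℝ → ℝ := fun s => 2 * s + 2 * (1 - s * β₁) * β / D with hu
  set w : ℝ → ℝ := fun s => -2 * (1 - s * β₁) / D with hw
  -- Adding the values for both signs makes the constant independent of `s`.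
  refine ⟨1 + (u 1 ^ 2 + w 1 ^ 2) + (u (-1) ^ 2 + w (-1) ^ 2), by positivity,
    fun τ N hτ hN hnd => ⟨k, hk1, ?_, ?_⟩⟩
  · rcases hnd with h | h
    · omega
    · rw [hkN]
      · exact hN
      · intro h'
        apply h
        rw [galerkinCoeff_eq α τ 1, galerkinCoeff_eq α τ 2, ← h']
        ring
  · intro s a b q hs hq
    set A := galerkinCoeff α τ 0 with hA
    have h0 : q 0 = A / 4 * (β₁ * a + s * b) := by
      rw [hq, zero_add, galerkinCoeff_eq α τ 1]; ring
    have hk : q k = A / 4 * (galerkinRatio α (k + 1) * a + s * β * b) := by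
      rw [hq, galerkinCoeff_eq α τ (k + 1), galerkinCoeff_eq α τ k]; ring
    have hs2 : s * s = 1 := by rcases hs with rfl | rfl <;> norm_num
    have hlin : A * (1 / 2 * (b + a)) = u s * q 0 + w s * q k := by
      have hd : β * q 0 - q k = A / 4 * D * a := by rw [h0, hk, hD]; ring
      have e : u s * q 0 + w s * q k
          = 2 * s * q 0 + 2 * (1 - s * β₁) / D * (β * q 0 - q k) := by
        simp only [hu, hw]; ring
      have e2 : 2 * (1 - s * β₁) / D * (A / 4 * D * a) = (1 - s * β₁) * A / 2 * a := by
        field_simp; ring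
      rw [e, hd, e2, h0]
      linear_combination (-A / 2 * b) * hs2
    rw [hlin]
    have hcs : (u s * q 0 + w s * q k) ^ 2 ≤ (u s ^ 2 + w s ^ 2) * (q 0 ^ 2 + q k ^ 2) := by
      nlinarith [sq_nonneg (u s * q k - w s * q 0)]
    refine hcs.trans ?_
    refine mul_le_mul_of_nonneg_right ?_ (by positivity)
    have h1 : 0 ≤ u 1 ^ 2 + w 1 ^ 2 := by positivity
    have h2 : 0 ≤ u (-1) ^ 2 + w (-1) ^ 2 := by positivity
    rcases hs with rfl | rfl <;> linarith

/-! ### Mesh-independent damping estimate -/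

/-- The estimate of the damping terms, for one component. -/
theorem exists_component_estimate {α : ℝ} (hα₀ : 0 < α) (hα₁ : α < 1) : ∃ c : ℝ, 0 < c ∧
    ∀ (T : ℝ) (J N : ℕ), 0 < T → 1 ≤ J → 1 ≤ N → N ≤ J →
      (2 ≤ N ∨ galerkinCoeff α (T / J) 1 ^ 2 ≠
        galerkinCoeff α (T / J) 0 * galerkinCoeff α (T / J) 2) →
      ∀ (s a b : ℝ) (x q : ℕ → ℝ), (s = 1 ∨ s = -1) → x 0 = 1 / 2 * (b + a) →
        (∀ n, q n = 1 / 4 * (galerkinCoeff α (T / J) (n + 1) * a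
          + s * galerkinCoeff α (T / J) n * b)) →
        (∀ n ≤ N, 0 ≤ T / J * ∑ m ∈ Icc 1 n, x m *
            (∑ j ∈ range (m + 1), galerkinCoeff α (T / J) j * x (m - j) + q m)
          + c * sobolevScalar ((1 - α) / 2) (cellRight T J N) (stepReal T J q)) ∧
        sobolevScalar (-(1 - α) / 2) (cellRight T J N) (stepReal T J x)
          ≤ c * (T / J * ∑ m ∈ Icc 1 N, x m *
              (∑ j ∈ range (m + 1), galerkinCoeff α (T / J) j * x (m - j) + q m)
            + c * sobolevScalar ((1 - α) / 2) (cellRight T J N) (stepReal T J q)) := by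
  obtain ⟨c₀, hc₀, hinit⟩ := exists_sq_le_initCorr hα₁
  have hκ := levyConst_pos (p := 2 - α) (by linarith) (by linarith)
  obtain ⟨c₁, hc₁, hdamp⟩ := exists_damping_ge hα₀ hα₁
    (c₀ := c₀ * (2 * levyConst (2 - α))) (by positivity)
  obtain ⟨c₂, hc₂, hhalf⟩ := exists_spec_halfSeq_le (p := 2 - α) (by linarith) (by linarith)
  have hΓ : 0 < Real.Gamma (3 - α) := Real.Gamma_pos_of_pos (by linarith)
  set κ := levyConst (2 - α)
  set Γ := Real.Gamma (3 - α)
  set e₁ := c₁ * Γ * (Real.pi ^ 3 / 2 * 2 ^ α) with he₁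
  set e₂ := 1 / (2 * Real.pi) * 2 ^ (-(2 - α)) * c₂ * (4 * κ * Γ) with he₂
  have he₁0 : 0 < e₁ := by positivity
  have he₂0 : 0 < e₂ := by positivity
  refine ⟨e₁ + e₂, by positivity, fun T J N hT hJ hN hNJ hnd s a b x q hs hx0 hq => ?_⟩
  have hτ : 0 < T / J := by positivity
  obtain ⟨k, hk1, hkN, hk⟩ := hinit (T / J) N hτ hN hnd
  have hup := sobolevScalar_stepReal_le hα₀ hα₁ hT hJ hNJ x
  have hlow := low_le_sobolevScalar_stepReal hα₀ hα₁ hT hJ hNJ q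
  have hR := sobolevScalar_nonneg ((1 - α) / 2) (cellRight T J N) (stepReal T J q)
  have hnh := halfCount_eq J N
  set τ := T / J
  set R := sobolevScalar ((1 - α) / 2) (cellRight T J N) (stepReal T J q)
  set nh := halfCount J N
  set L := low (2 - α) nh (halfSeq q) with hL
  have hq0L : q 0 ^ 2 ≤ κ * L := by
    simpa [halfSeq] using sq_le_low (p := 2 - α) (by linarith) (by linarith) (n := nh) (k := 0)
      (by omega) (halfSeq q)
  have hqkL : q k ^ 2 ≤ κ * L := by
    have := sq_le_low (p := 2 - α) (by linarith) (by linarith) (n := nh) (k := 2 * k - 1)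
      (by omega) (halfSeq q)
    have h3 : halfSeq q (2 * k - 1) = q k := by unfold halfSeq; congr 1; omega
    rwa [h3] at this
  have h0 : (galerkinCoeff α τ 0 * x 0) ^ 2 ≤ c₀ * (2 * κ) * L := by
    rw [hx0]
    refine (hk s a b q hs hq).trans ?_
    calc c₀ * (q 0 ^ 2 + q k ^ 2) ≤ c₀ * (κ * L + κ * L) := by gcongr
      _ = _ := by ring
  -- These two powers of `τ` match the factors `(τ / 2) ^ (2 - α)` and `(τ / 2) ^ (-α)` of the
  -- Sobolev bounds, so the mesh size cancels.
  have hτA : τ * galerkinCoeff α τ 0 = τ ^ (2 - α) / Γ := by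
    rw [galerkinCoeff_zero, show (2 - α) = (1 - α) + 1 by ring, Real.rpow_add_one hτ.ne']
    ring
  have hτA' : τ / galerkinCoeff α τ 0 = Γ * τ ^ α := by
    have : τ ^ α * τ ^ (1 - α) = τ := by rw [← Real.rpow_add hτ]; ring_nf; simp
    rw [div_eq_iff (galerkinCoeff_zero_pos hα₁ hτ).ne']
    change τ = Γ * τ ^ α * (τ ^ (1 - α) / Γ)
    field_simp
    linarith
  have hhalfpow : ∀ r : ℝ, (τ / 2) ^ r = 2 ^ (-r) * τ ^ r := by
    intro r
    rw [Real.div_rpow hτ.le two_pos.le, Real.rpow_neg two_pos.le]; ring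
  have hLR : τ * (c₁ / galerkinCoeff α τ 0 * L) ≤ e₁ * R := by
    have e : τ * (c₁ / galerkinCoeff α τ 0 * L) = c₁ * (τ / galerkinCoeff α τ 0) * L := by ring
    rw [e, hτA']
    calc c₁ * (Γ * τ ^ α) * L ≤ c₁ * (Γ * τ ^ α) * (Real.pi ^ 3 / 2 * (τ / 2) ^ (-α) * R) := by
          gcongr
      _ = e₁ * R * (τ ^ α * τ ^ (-α)) := by rw [hhalfpow, neg_neg, he₁]; ring
      _ = e₁ * R := by rw [← Real.rpow_add hτ]; simp
  have main : ∀ n ≤ N, τ ^ (2 - α) / Γ / (4 * κ) * spec (2 - α) (n + 1) x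
      ≤ τ * ∑ m ∈ Icc 1 n, x m * (∑ j ∈ range (m + 1), galerkinCoeff α τ j * x (m - j) + q m)
        + e₁ * R := by
    intro n hn
    have h1 := mul_le_mul_of_nonneg_left (hdamp nh N n hN hn hnh τ x q hτ h0) hτ.le
    have h2 : τ * (galerkinCoeff α τ 0 / (4 * κ) * spec (2 - α) (n + 1) x)
        = τ ^ (2 - α) / Γ / (4 * κ) * spec (2 - α) (n + 1) x := by rw [← hτA]; ring
    rw [mul_sub, h2] at h1
    linarith
  have hmono : e₁ * R ≤ (e₁ + e₂) * R := by gcongr; linarith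
  have hS : ∀ n, 0 ≤ τ ^ (2 - α) / Γ / (4 * κ) * spec (2 - α) (n + 1) x := fun n =>
    mul_nonneg (by positivity) (spec_nonneg _ _ _)
  refine ⟨fun n hn => by linarith [main n hn, hS n], ?_⟩
  have hN' := main N le_rfl
  calc _ ≤ 1 / (2 * Real.pi) * (τ / 2) ^ (2 - α) * spec (2 - α) nh (halfSeq x) := hup
    _ ≤ 1 / (2 * Real.pi) * (τ / 2) ^ (2 - α) * (c₂ * spec (2 - α) (N + 1) x) := by
        gcongr; exact hhalf nh N hnh x
    _ = e₂ * (τ ^ (2 - α) / Γ / (4 * κ) * spec (2 - α) (N + 1) x) := by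
        rw [hhalfpow, he₂]; field_simp
    _ ≤ (e₁ + e₂) * (τ ^ (2 - α) / Γ / (4 * κ) * spec (2 - α) (N + 1) x) := by
        refine mul_le_mul_of_nonneg_right ?_ (hS N); linarith
    _ ≤ _ := by gcongr; linarith

/-! ### Matrix square roots and passage to vectors -/

theorem app_eq {d : ℕ} (A : Matrix (Fin d) (Fin d) ℝ) (x : EuclideanSpace ℝ (Fin d)) :
    app A x = Matrix.toEuclideanLin A x := rfl

theorem app_app {d : ℕ} (A B : Matrix (Fin d) (Fin d) ℝ) (x : EuclideanSpace ℝ (Fin d)) :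
    app A (app B x) = app (A * B) x := by
  simp [app, Matrix.mulVec_mulVec]

theorem msqrt_mul_msqrt {d : ℕ} {A : Matrix (Fin d) (Fin d) ℝ} (hA : A.PosSemidef) :
    msqrt A * msqrt A = A :=
  CFC.sqrt_mul_sqrt_self A (Matrix.nonneg_iff_posSemidef.2 hA)

theorem msqrt_transpose {d : ℕ} (A : Matrix (Fin d) (Fin d) ℝ) : (msqrt A).transpose = msqrt A := by
  have h : (msqrt A).PosSemidef := Matrix.nonneg_iff_posSemidef.1 (CFC.sqrt_nonneg A)
  simpa [Matrix.conjTranspose_eq_transpose_of_trivial] using h.isHermitian.eq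

theorem inner_app_left {d : ℕ} {B : Matrix (Fin d) (Fin d) ℝ} (hB : B.transpose = B)
    (x y : EuclideanSpace ℝ (Fin d)) : inner ℝ (app B x) y = inner ℝ x (app B y) := by
  simp only [EuclideanSpace.inner_eq_star_dotProduct, app, star_trivial]
  rw [Matrix.dotProduct_mulVec, ← Matrix.mulVec_transpose, hB, dotProduct_comm]

theorem inner_app_msqrt {d : ℕ} {A : Matrix (Fin d) (Fin d) ℝ} (hA : A.PosSemidef)
    (x y : EuclideanSpace ℝ (Fin d)) :
    inner ℝ (app A x) y = inner ℝ (app (msqrt A) x) (app (msqrt A) y) := by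
  conv_lhs => rw [← msqrt_mul_msqrt hA, ← app_app]
  exact inner_app_left (msqrt_transpose A) _ _

theorem inner_app_inv_msqrt {d : ℕ} {A : Matrix (Fin d) (Fin d) ℝ} (hA : A.PosDef)
    (f x : EuclideanSpace ℝ (Fin d)) :
    inner ℝ f x = inner ℝ (app (msqrt A)⁻¹ f) (app (msqrt A) x) := by
  have hdet : IsUnit (msqrt A).det := by
    have h := congrArg Matrix.det (msqrt_mul_msqrt hA.posSemidef)
    rw [Matrix.det_mul] at h
    refine isUnit_iff_ne_zero.2 fun h0 => ?_
    rw [h0, zero_mul] at h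
    exact hA.det_pos.ne h
  rw [← inner_app_left (msqrt_transpose A), app_app, Matrix.mul_nonsing_inv _ hdet]
  simp [app]

theorem app_stepFun_apply {d : ℕ} (A : Matrix (Fin d) (Fin d) ℝ) (T : ℝ) (J : ℕ)
    (w : ℕ → EuclideanSpace ℝ (Fin d)) (i : Fin d) (t : ℝ) :
    app A (stepFun T J w t) i = stepReal T J (fun n => app A (w n) i) t := by
  simp only [app_eq, stepFun, map_sum, stepReal, WithLp.ofLp_sum, Finset.sum_apply]
  refine sum_congr rfl fun n _ => ?_
  by_cases h : t ∈ Set.Icc (cellLeft T J n) (cellRight T J n)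
  · simp only [Set.indicator_of_mem h]
  · simp only [Set.indicator_of_notMem h, map_zero]; rfl

theorem sobolevNormSq_app_stepFun {d : ℕ} (A : Matrix (Fin d) (Fin d) ℝ) (σ t T : ℝ) (J : ℕ)
    (w : ℕ → EuclideanSpace ℝ (Fin d)) :
    sobolevNormSq σ t (fun t => app A (stepFun T J w t))
      = ∑ i, sobolevScalar σ t (stepReal T J fun n => app A (w n) i) := by
  simp only [sobolevNormSq, sobolevScalar, app_stepFun_apply]

/-- The discrete power dissipated by the fractional damping at the step `m`. -/
def dampingPower {d : ℕ} (C : Matrix (Fin d) (Fin d) ℝ) (α τ s : ℝ)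
    (v : ℕ → EuclideanSpace ℝ (Fin d)) (m : ℕ) : ℝ :=
  inner ℝ (app C (∑ j ∈ range (m + 1), galerkinCoeff α τ j • vTilde v (m - j)
    + initCorr α τ s v m)) (vTilde v m)

theorem dampingPower_eq {d : ℕ} {C : Matrix (Fin d) (Fin d) ℝ} (hC : C.PosSemidef) (α τ s : ℝ)
    (v : ℕ → EuclideanSpace ℝ (Fin d)) (m : ℕ) :
    dampingPower C α τ s v m = ∑ i, app (msqrt C) (vTilde v m) i *
      (∑ j ∈ range (m + 1), galerkinCoeff α τ j * app (msqrt C) (vTilde v (m - j)) i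
        + app (msqrt C) (initCorr α τ s v m) i) := by
  rw [dampingPower, inner_app_msqrt hC, PiLp.inner_apply]
  refine sum_congr rfl fun i _ => ?_
  simp only [app_eq, map_add, map_sum, map_smul, RCLike.inner_apply, conj_trivial, PiLp.add_apply,
    WithLp.ofLp_sum, Finset.sum_apply, PiLp.smul_apply, smul_eq_mul]

/-- The scalar coefficients commute with `C^{1/2}`, so the estimate splits over the components of
`C^{1/2} ṽ`, with a constant independent of `d` and `C`. -/
theorem exists_damping_estimate {α : ℝ} (hα₀ : 0 < α) (hα₁ : α < 1) : ∃ c : ℝ, 0 < c ∧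
    ∀ (T : ℝ) (J N : ℕ), 0 < T → 1 ≤ J → 1 ≤ N → N ≤ J →
      (2 ≤ N ∨ galerkinCoeff α (T / J) 1 ^ 2 ≠
        galerkinCoeff α (T / J) 0 * galerkinCoeff α (T / J) 2) →
      ∀ (d : ℕ) (C : Matrix (Fin d) (Fin d) ℝ), C.PosSemidef →
      ∀ (s : ℝ) (v : ℕ → EuclideanSpace ℝ (Fin d)), (s = 1 ∨ s = -1) →
        (∀ n ≤ N, 0 ≤ T / J * ∑ m ∈ Icc 1 n, dampingPower C α (T / J) s v m
          + c * sobolevNormSq ((1 - α) / 2) (cellRight T J N)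
              (fun t => app (msqrt C) (stepFun T J (initCorr α (T / J) s v) t))) ∧
        sobolevNormSq (-(1 - α) / 2) (cellRight T J N)
            (fun t => app (msqrt C) (stepFun T J (vTilde v) t))
          ≤ c * (T / J * ∑ m ∈ Icc 1 N, dampingPower C α (T / J) s v m
            + c * sobolevNormSq ((1 - α) / 2) (cellRight T J N)
              (fun t => app (msqrt C) (stepFun T J (initCorr α (T / J) s v) t))) := by
  obtain ⟨c, hc, hcomp⟩ := exists_component_estimate hα₀ hα₁
  refine ⟨c, hc, fun T J N hT hJ hN hNJ hnd d C hC s v hs => ?_⟩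
  have h := fun i : Fin d => hcomp T J N hT hJ hN hNJ hnd s (app (msqrt C) (v 0) i)
    (app (msqrt C) (v 1) i) (fun n => app (msqrt C) (vTilde v n) i)
    (fun n => app (msqrt C) (initCorr α (T / J) s v n) i) hs
    (by simp only [app_eq, vTilde, map_add, map_smul]; rfl)
    (fun n => by simp only [app_eq, initCorr, map_add, map_smul]; rfl)
  have hsum : ∀ n, T / J * ∑ m ∈ Icc 1 n, dampingPower C α (T / J) s v m
      = ∑ i, T / J * ∑ m ∈ Icc 1 n, app (msqrt C) (vTilde v m) i *
      (∑ j ∈ range (m + 1), galerkinCoeff α (T / J) j * app (msqrt C) (vTilde v (m - j)) i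
        + app (msqrt C) (initCorr α (T / J) s v m) i) := by
    intro n
    rw [← mul_sum, sum_comm]
    simp only [dampingPower_eq hC]
  rw [sobolevNormSq_app_stepFun, sobolevNormSq_app_stepFun]
  constructor
  · intro n hn
    rw [hsum, mul_sum, ← sum_add_distrib]
    exact sum_nonneg fun i _ => (h i).1 n hn
  · refine (sum_le_sum fun i _ => (h i).2).trans (le_of_eq ?_)
    rw [hsum, mul_sum univ _ c, ← sum_add_distrib, mul_sum]

theorem sobolevNormSq_nonneg {d : ℕ} (σ t : ℝ) (g : ℝ → EuclideanSpace ℝ (Fin d)) :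
    0 ≤ sobolevNormSq σ t g :=
  sum_nonneg fun _ _ => integral_nonneg fun ω => by positivity

/-! ### Energy balance and absorption of the load -/

/-- The mean displacement `τ ∑_{j ≤ n} ṽ_j + d₀ - τ ṽ_0 / 2`. -/
def displacement {d : ℕ} (τ : ℝ) (d₀ : EuclideanSpace ℝ (Fin d))
    (v : ℕ → EuclideanSpace ℝ (Fin d)) (n : ℕ) : EuclideanSpace ℝ (Fin d) :=
  τ • ∑ j ∈ range (n + 1), vTilde v j + (d₀ - (τ / 2) • vTilde v 0)

theorem displacement_succ {d : ℕ} (τ : ℝ) (d₀ : EuclideanSpace ℝ (Fin d))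
    (v : ℕ → EuclideanSpace ℝ (Fin d)) (n : ℕ) :
    displacement τ d₀ v (n + 1) = displacement τ d₀ v n + τ • vTilde v (n + 1) := by
  simp only [displacement, sum_range_succ _ (n + 1), smul_add]; abel

/-- The shift by `τ ṽ_0 / 2` in `displacement` makes the stiffness argument a midpoint of successive
displacements, so that the stiffness term telescopes. -/
theorem add_smul_sum_vTilde {d : ℕ} (τ : ℝ) (d₀ : EuclideanSpace ℝ (Fin d))
    (v : ℕ → EuclideanSpace ℝ (Fin d)) (n : ℕ) :
    d₀ + τ • ∑ j ∈ Icc 1 (n + 1), (1 / 2 : ℝ) • (vTilde v j + vTilde v (j - 1))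
      = (1 / 2 : ℝ) • (displacement τ d₀ v (n + 1) + displacement τ d₀ v n) := by
  induction n with
  | zero =>
    rw [displacement_succ]
    simp [displacement]
    module
  | succ n ih =>
    rw [sum_Icc_succ_top (by omega), smul_add, ← add_assoc, ih, displacement_succ τ d₀ v (n + 1),
      displacement_succ τ d₀ v n, Nat.add_sub_cancel]
    module

theorem inner_app_half_add {d : ℕ} {A : Matrix (Fin d) (Fin d) ℝ} (hA : A.PosSemidef)
    (x y : EuclideanSpace ℝ (Fin d)) : inner ℝ (app A (x - y)) ((1 / 2 : ℝ) • (x + y))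
      = (‖app (msqrt A) x‖ ^ 2 - ‖app (msqrt A) y‖ ^ 2) / 2 := by
  rw [inner_app_msqrt hA, app_eq, app_eq, map_sub, map_smul, map_add, inner_smul_right,
    inner_sub_left, inner_add_right, inner_add_right, real_inner_self_eq_norm_sq,
    real_inner_self_eq_norm_sq, real_inner_comm (Matrix.toEuclideanLin (msqrt A) x), app_eq, app_eq]
  ring

/-- The energy balance of one step. -/
theorem energy_step {d : ℕ} {M C K : Matrix (Fin d) (Fin d) ℝ} (hM : M.PosDef)
    (hK : K.PosSemidef) {α τ s : ℝ} (hτ : 0 < τ) {J : ℕ} {d₀ : EuclideanSpace ℝ (Fin d)}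
    {v f : ℕ → EuclideanSpace ℝ (Fin d)} (h : IsSchemeSolution M C K α τ s J d₀ v f) {n : ℕ}
    (hn : n + 1 ≤ J) :
    ‖app (msqrt M) (vHat v (n + 1))‖ ^ 2 / 2 + τ * dampingPower C α τ s v (n + 1)
        + ‖app (msqrt K) (displacement τ d₀ v (n + 1))‖ ^ 2 / 2
      = ‖app (msqrt M) (vHat v n)‖ ^ 2 / 2 + ‖app (msqrt K) (displacement τ d₀ v n)‖ ^ 2 / 2
        + τ * inner ℝ (fTilde f (n + 1)) (vTilde v (n + 1)) := by
  have hs := h (n + 1) (mem_Icc.2 ⟨by omega, hn⟩)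
  rw [add_smul_sum_vTilde, Nat.add_sub_cancel] at hs
  have hv1 : (1 / (2 * τ)) • (v (n + 1 + 1) - v n) = τ⁻¹ • (vHat v (n + 1) - vHat v n) := by
    have : (1 / (2 * τ)) = τ⁻¹ * (1 / 2) := by field_simp
    rw [this, mul_smul]; simp only [vHat]; congr 1; module
  have hv2 : vTilde v (n + 1) = (1 / 2 : ℝ) • (vHat v (n + 1) + vHat v n) := by
    simp only [vHat, vTilde]; module
  have hv3 : τ • vTilde v (n + 1) = displacement τ d₀ v (n + 1) - displacement τ d₀ v n := by
    rw [displacement_succ]; abel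
  have hm : τ * inner ℝ (app M ((1 / (2 * τ)) • (v (n + 1 + 1) - v n))) (vTilde v (n + 1))
      = (‖app (msqrt M) (vHat v (n + 1))‖ ^ 2 - ‖app (msqrt M) (vHat v n)‖ ^ 2) / 2 := by
    rw [← inner_app_half_add hM.posSemidef, hv1, hv2, app_eq, map_smul, real_inner_smul_left,
      ← app_eq]
    field_simp
  have hk : τ * inner ℝ (app K ((1 / 2 : ℝ) • (displacement τ d₀ v (n + 1)
        + displacement τ d₀ v n))) (vTilde v (n + 1))
      = (‖app (msqrt K) (displacement τ d₀ v (n + 1))‖ ^ 2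
        - ‖app (msqrt K) (displacement τ d₀ v n)‖ ^ 2) / 2 := by
    rw [← inner_app_half_add hK, ← inner_smul_right, hv3, inner_app_msqrt hK, inner_app_msqrt hK,
      real_inner_comm]
  have := congrArg (fun z => τ * inner ℝ z (vTilde v (n + 1))) hs
  simp only [inner_add_left, mul_add] at this
  rw [hm, hk] at this
  rw [← this, dampingPower]
  ring

theorem energy_sum_le {d : ℕ} {M C K : Matrix (Fin d) (Fin d) ℝ} (hM : M.PosDef)
    (hK : K.PosSemidef) {α τ s : ℝ} (hτ : 0 < τ) {J : ℕ} {d₀ : EuclideanSpace ℝ (Fin d)}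
    {v f : ℕ → EuclideanSpace ℝ (Fin d)} (h : IsSchemeSolution M C K α τ s J d₀ v f) {n : ℕ}
    (hn : n ≤ J) :
    ‖app (msqrt M) (vHat v n)‖ ^ 2 / 2 + τ * ∑ m ∈ Icc 1 n, dampingPower C α τ s v m
        + ‖app (msqrt K) (displacement τ d₀ v n)‖ ^ 2 / 2
      ≤ ‖app (msqrt M) (vHat v 0)‖ ^ 2 / 2 + ‖app (msqrt K) (displacement τ d₀ v 0)‖ ^ 2 / 2
        + τ * ∑ m ∈ Icc 1 n, ‖app (msqrt M)⁻¹ (fTilde f m)‖ *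
          ((‖app (msqrt M) (vHat v m)‖ + ‖app (msqrt M) (vHat v (m - 1))‖) / 2) := by
  induction n with
  | zero => simp
  | succ n ih =>
    have hstep := energy_step hM hK hτ h hn
    have ih := ih (by omega)
    rw [sum_Icc_succ_top (by omega), sum_Icc_succ_top (by omega), mul_add, mul_add,
      Nat.add_sub_cancel]
    have hv2 : vTilde v (n + 1) = (1 / 2 : ℝ) • (vHat v (n + 1) + vHat v n) := by
      simp only [vHat, vTilde]; module
    have hf : inner ℝ (fTilde f (n + 1)) (vTilde v (n + 1)) ≤
        ‖app (msqrt M)⁻¹ (fTilde f (n + 1))‖ *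
          ((‖app (msqrt M) (vHat v (n + 1))‖ + ‖app (msqrt M) (vHat v n)‖) / 2) := by
      rw [inner_app_inv_msqrt hM]
      refine (real_inner_le_norm _ _).trans ?_
      gcongr
      rw [hv2, app_eq, map_smul, map_add, norm_smul, Real.norm_of_nonneg (by norm_num)]
      have := norm_add_le (Matrix.toEuclideanLin (msqrt M) (vHat v (n + 1)))
        (Matrix.toEuclideanLin (msqrt M) (vHat v n))
      simp only [app_eq]
      linarith
    have := mul_le_mul_of_nonneg_left hf hτ.le
    linarith

/-- The bound that follows from the summed energy balance. -/
theorem sup_add_le_of_energy {N : ℕ} (hN : 1 ≤ N) {a F P k : ℕ → ℝ} {c I L S τ : ℝ}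
    (hc : 0 < c) (hτ : 0 < τ)
    (hF : ∀ n, 0 ≤ F n) (hk : ∀ n, 0 ≤ k n)
    (ha0 : a 0 ^ 2 ≤ I) (hk0 : k 0 ≤ 2 * I) (hP : ∀ n ≤ N, 0 ≤ P n + c * I)
    (hL : L ≤ c * (P N + c * I)) (hS : S ≤ 2 * k N + 4 * I)
    (hen : ∀ n ≤ N, a n ^ 2 / 2 + P n + k n / 2
      ≤ a 0 ^ 2 / 2 + k 0 / 2 + τ * ∑ m ∈ Icc 1 n, F m * ((a m + a (m - 1)) / 2)) :
    (Icc 1 N).sup' (nonempty_Icc.mpr hN) (fun n => a n ^ 2) + (L + S)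
      ≤ (25 + 16 * c + 2 * c ^ 2) * (I + (τ * ∑ n ∈ Icc 1 N, F n) ^ 2) := by
  set X := (Icc 1 N).sup' (nonempty_Icc.mpr hN) (fun n => a n ^ 2) with hX
  set G := τ * ∑ n ∈ Icc 1 N, F n with hG
  have hI : 0 ≤ I := (sq_nonneg _).trans ha0
  have haX : ∀ n ∈ Icc 1 N, a n ^ 2 ≤ X := fun n hn => le_sup' (fun n => a n ^ 2) hn
  have hX0 : 0 ≤ X := (sq_nonneg _).trans (haX 1 (mem_Icc.2 ⟨le_rfl, hN⟩))
  -- One bound for all `a n`, including `a 0`, which the maximum `X` omits.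
  set b := Real.sqrt (X + I) with hb
  have hb2 : b ^ 2 = X + I := Real.sq_sqrt (by positivity)
  have hab : ∀ n ≤ N, a n ≤ b := by
    intro n hn
    refine Real.le_sqrt_of_sq_le ?_
    rcases Nat.eq_zero_or_pos n with rfl | h
    · linarith
    · linarith [haX n (mem_Icc.2 ⟨h, hn⟩)]
  have hb0 : 0 ≤ b := Real.sqrt_nonneg _
  have hload : ∀ n ≤ N, τ * ∑ m ∈ Icc 1 n, F m * ((a m + a (m - 1)) / 2) ≤ G * b := by
    intro n hn
    rw [hG, mul_assoc, sum_mul]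
    gcongr
    calc ∑ m ∈ Icc 1 n, F m * ((a m + a (m - 1)) / 2) ≤ ∑ m ∈ Icc 1 n, F m * b := by
          refine sum_le_sum fun m hm => ?_
          have hm' := mem_Icc.1 hm
          have h1 := hab m (by omega)
          have h2 := hab (m - 1) (by omega)
          exact mul_le_mul_of_nonneg_left (by linarith) (hF m)
      _ ≤ _ := by
          refine sum_le_sum_of_subset_of_nonneg (Icc_subset_Icc_right hn) fun m _ _ => ?_
          exact mul_nonneg (hF m) hb0
  -- The weight `1 / 4` leaves `X / 2` on the right after doubling, which the left-hand side
  -- absorbs.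
  have hGb : G * b ≤ (X + I) / 4 + G ^ 2 := by nlinarith [sq_nonneg (b / 2 - G)]
  have hXle : X ≤ (7 + 4 * c) * I + 4 * G ^ 2 := by
    have : X ≤ (3 + 2 * c) * I + 2 * (G * b) := by
      refine sup'_le _ _ fun n hn => ?_
      have hn' := (mem_Icc.1 hn).2
      have := hen n hn'
      have := hload n hn'
      have := hP n hn'
      have := hk n
      linarith
    linarith
  have h1 := hen N le_rfl
  have h2 := hload N le_rfl
  have h3 := hP N le_rfl
  have hcI : 0 ≤ c * I := by positivity
  have hcG : 0 ≤ c * G ^ 2 := by positivity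
  have hccG : 0 ≤ c ^ 2 * G ^ 2 := by positivity
  have hPN : P N + c * I ≤ (4 + 2 * c) * I + 2 * G ^ 2 := by
    have := hk N
    have := sq_nonneg (a N)
    linarith
  have hL' : L ≤ c * ((4 + 2 * c) * I + 2 * G ^ 2) := hL.trans (by gcongr)
  have hkN : k N ≤ (7 + 4 * c) * I + 4 * G ^ 2 := by
    have := sq_nonneg (a N)
    linarith
  nlinarith [sq_nonneg G]

theorem norm_add_sq_le_two {d : ℕ} (x y : EuclideanSpace ℝ (Fin d)) :
    ‖x + y‖ ^ 2 ≤ 2 * (‖x‖ ^ 2 + ‖y‖ ^ 2) := by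
  have := parallelogram_law_with_norm ℝ x y
  nlinarith [sq_nonneg ‖x - y‖]

end FracNewmark

end

open FracNewmark

/-! ### The two stability estimates -/

theorem theorem1 (α : ℝ) (hα₀ : 0 < α) (hα₁ : α < 1) :
    ∃ c : ℝ, 0 < c ∧ ∀ T : ℝ, 0 < T → ∃ cT : ℝ, 0 < cT ∧
      ∀ (d : ℕ) (M C K : Matrix (Fin d) (Fin d) ℝ),
        M.PosDef → C.PosSemidef → K.PosSemidef →
      ∀ (J : ℕ), 1 ≤ J →
      ∀ (s : ℝ), s = 1 ∨ s = -1 →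
      ∀ (d₀ : EuclideanSpace ℝ (Fin d)) (v f : ℕ → EuclideanSpace ℝ (Fin d)),
        FracNewmark.IsSchemeSolution M C K α (T / J) s J d₀ v f →
      ∀ (N : ℕ) (hN : 1 ≤ N), N ≤ J →
        (2 ≤ N ∨ FracNewmark.galerkinCoeff α (T / J) 1 ^ 2 ≠
          FracNewmark.galerkinCoeff α (T / J) 0 * FracNewmark.galerkinCoeff α (T / J) 2) →
        (‖FracNewmark.app (FracNewmark.msqrt M) (FracNewmark.vHat v N)‖ ^ 2
            + FracNewmark.dampStiffEnergy C K α T J N v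
          ≤ cT * (FracNewmark.initialTerms M C K α T s J N d₀ v
            + (T / J) * ∑ n ∈ Finset.Icc 1 N,
                ‖FracNewmark.app (FracNewmark.msqrt M)⁻¹ (FracNewmark.fTilde f n)‖ ^ 2)) ∧
        ((Finset.Icc 1 N).sup' (Finset.nonempty_Icc.mpr hN)
              (fun n => ‖FracNewmark.app (FracNewmark.msqrt M) (FracNewmark.vHat v n)‖ ^ 2)
            + FracNewmark.dampStiffEnergy C K α T J N v
          ≤ c * (FracNewmark.initialTerms M C K α T s J N d₀ v
            + ((T / J) * ∑ n ∈ Finset.Icc 1 N,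
                ‖FracNewmark.app (FracNewmark.msqrt M)⁻¹ (FracNewmark.fTilde f n)‖) ^ 2)) := by
  obtain ⟨c, hc, hdamp⟩ := exists_damping_estimate hα₀ hα₁
  set c' := 25 + 16 * c + 2 * c ^ 2 with hc'
  have hc'0 : 0 < c' := by positivity
  refine ⟨c', hc'0, fun T hT => ⟨c' * (1 + T), by positivity,
    fun d M C K hM hC hK J hJ s hs d₀ v f hsol N hN hNJ hnd => ?_⟩⟩
  have hτ : 0 < T / J := by positivity
  obtain ⟨hP, hL⟩ := hdamp T J N hT hJ hN hNJ hnd d C hC s v hs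
  have hR0 := sobolevNormSq_nonneg ((1 - α) / 2) (cellRight T J N)
    (fun t => app (msqrt C)
      (stepFun T J (initCorr α (T / J) s v) t))
  set I := initialTerms M C K α T s J N d₀ v with hI
  set R := sobolevNormSq ((1 - α) / 2) (cellRight T J N)
    (fun t => app (msqrt C)
      (stepFun T J (initCorr α (T / J) s v) t)) with hR
  set τ := T / J with hτdef
  have hIeq : I = ‖app (msqrt M) (vHat v 0)‖ ^ 2
      + ‖app (msqrt K) d₀‖ ^ 2
      + ‖τ • app (msqrt K) (vTilde v 0)‖ ^ 2 + R := rfl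
  have hRI : R ≤ I := by
    rw [hIeq]
    nlinarith [sq_nonneg ‖app (msqrt M) (vHat v 0)‖]
  have hcRI : c * R ≤ c * I := by gcongr
  -- Used with `e = 1 / 2` for the displacement at `0`, and with `e = -1 / 2` for the offset between
  -- the final displacement and `τ ∑ ṽ_n`.
  have hshift : ∀ e : ℝ, e ^ 2 = 1 / 4 →
      ‖app (msqrt K) (d₀ + (e * τ) • vTilde v 0)‖ ^ 2
        ≤ 2 * I := by
    intro e he
    have h1 := norm_add_sq_le_two (app (msqrt K) d₀)
      (e • τ • app (msqrt K) (vTilde v 0))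
    have h2 : app (msqrt K) (d₀ + (e * τ) • vTilde v 0)
        = app (msqrt K) d₀
          + e • τ • app (msqrt K) (vTilde v 0) := by
      simp only [app_eq, map_add, map_smul, mul_smul]
    rw [h2]
    refine h1.trans ?_
    rw [norm_smul e, mul_pow, Real.norm_eq_abs, sq_abs, he, hIeq]
    nlinarith [sq_nonneg ‖app (msqrt M) (vHat v 0)‖,
      sq_nonneg ‖τ • app (msqrt K) (vTilde v 0)‖]
  have hmain := sup_add_le_of_energy hN
    (a := fun n => ‖app (msqrt M) (vHat v n)‖)
    (F := fun n => ‖app (msqrt M)⁻¹ (fTilde f n)‖)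
    (P := fun n => τ * ∑ m ∈ Finset.Icc 1 n, dampingPower C α τ s v m)
    (k := fun n => ‖app (msqrt K)
      (displacement τ d₀ v n)‖ ^ 2)
    (c := c) (I := I) (τ := τ)
    (L := sobolevNormSq (-(1 - α) / 2) (cellRight T J N)
      (fun t => app (msqrt C)
        (stepFun T J (vTilde v) t)))
    (S := ‖app (msqrt K)
      (τ • ∑ n ∈ Finset.range (N + 1), vTilde v n)‖ ^ 2)
    hc hτ (fun n => norm_nonneg _) (fun n => by positivity)
    (by rw [hIeq]; nlinarith [sq_nonneg ‖app (msqrt K) d₀‖,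
          sq_nonneg ‖τ • app (msqrt K) (vTilde v 0)‖])
    (by
      have := hshift (1 / 2) (by norm_num)
      refine le_trans (le_of_eq ?_) this
      congr 3
      simp only [displacement, zero_add, Finset.range_one, Finset.sum_singleton]
      module)
    (fun n hn => (hP n hn).trans (by gcongr))
    (hL.trans (by gcongr))
    (by
      have h1 := norm_add_sq_le_two
        (app (msqrt K) (displacement τ d₀ v N))
        (-app (msqrt K) (d₀ + (-1 / 2 * τ) • vTilde v 0))
      have h2 : app (msqrt K)
          (τ • ∑ n ∈ Finset.range (N + 1), vTilde v n)
          = app (msqrt K) (displacement τ d₀ v N)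
            + -app (msqrt K)
              (d₀ + (-1 / 2 * τ) • vTilde v 0) := by
        simp only [app_eq]
        rw [← map_neg, ← map_add]
        congr 1
        simp only [displacement]
        module
      rw [h2]
      rw [norm_neg] at h1
      linarith [hshift (-1 / 2) (by norm_num)])
    (fun n hn => energy_sum_le hM hK hτ hsol (hn.trans hNJ))
  refine ⟨?_, hmain⟩
  have hsup : ‖app (msqrt M) (vHat v N)‖ ^ 2
      ≤ (Finset.Icc 1 N).sup' (Finset.nonempty_Icc.mpr hN)
        (fun n => ‖app (msqrt M) (vHat v n)‖ ^ 2) :=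
    Finset.le_sup' (fun n => ‖app (msqrt M) (vHat v n)‖ ^ 2)
      (Finset.mem_Icc.2 ⟨hN, le_rfl⟩)
  -- Cauchy–Schwarz over `N ≤ J` steps costs the factor `J τ = T`, the only source of dependence on
  -- `T`.
  have hcs := sq_sum_le_card_mul_sum_sq (s := Finset.Icc 1 N)
    (f := fun n => ‖app (msqrt M)⁻¹ (fTilde f n)‖)
  rw [Nat.card_Icc, Nat.add_sub_cancel] at hcs
  set Q := ∑ n ∈ Finset.Icc 1 N,
    ‖app (msqrt M)⁻¹ (fTilde f n)‖ ^ 2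
  have hQ : 0 ≤ Q := Finset.sum_nonneg fun n _ => by positivity
  have hI0 : 0 ≤ I := hR0.trans hRI
  have hload : (τ * ∑ n ∈ Finset.Icc 1 N,
      ‖app (msqrt M)⁻¹ (fTilde f n)‖) ^ 2
        ≤ T * (τ * Q) := by
    have hNJ' : (N : ℝ) ≤ J := by exact_mod_cast hNJ
    have hTJ : T = J * τ := by rw [hτdef]; field_simp
    rw [mul_pow]
    calc _ ≤ τ ^ 2 * (J * Q) := by
          gcongr; exact hcs.trans (by gcongr)
      _ = T * (τ * Q) := by rw [hTJ]; ring
  have hτQ : 0 ≤ τ * Q := by positivity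
  have hTI : 0 ≤ T * I := by positivity
  calc _ ≤ c' * (I + (τ * ∑ n ∈ Finset.Icc 1 N,
        ‖app (msqrt M)⁻¹ (fTilde f n)‖) ^ 2) :=
        (add_le_add hsup le_rfl).trans hmain
    _ ≤ c' * ((1 + T) * (I + τ * Q)) := by
        gcongr; linarith
    _ = _ := by ring
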